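/- **Problem.** There are $n$ independent arms. Arm $i$ has a hidden state in $\{g,b\}$ which moves from $b$ to $g$ with probability $\alpha_i>0$ and from $g$ to $b$ with probability $\beta_i>0$ in every time step, whether or not the arm is played; $\alpha_i+\beta_i<1$. In every time step at most $M\ge 1$ arms are played. A play of arm $i$ earns $r_i\ge 0$ if its state is $g$ and $0$ otherwise; the reward is banked and reveals nothing. At the end of the time step, before the states evolve, the player may probe arms, one after the other; a probe of arm $i$ costs $c_i\ge 0$ and reveals its current state. Policies may be randomized and depend on the history of plays and probe outcomes. At the start the state of every arm has just been observed. The value of a policy is its long-run expected time average of rewards minus probing costs, and $OPT$ is the supremum of the values (as upper limits) over all policies and start states. **Balanced linear programs.** Let $v_{it}=\frac{\alpha_i}{\alpha_i+\beta_i}(1-(1-\alpha_i-\beta_i)^t)$ and $u_{it}=\frac{\alpha_i}{\alpha_i+\beta_i}+\frac{\beta_i}{\alpha_i+\beta_i}(1-\alpha_i-\beta_i)^t$ be the probabilities that arm $i$ is in state $g$ when it was observed in state $b$, respectively $g$, $t$ steps ago, and let $R^i_{gt}=r_iu_{it}$, $R^i_{bt}=r_iv_{it}$. For a horizon $T$ the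 balanced dual is: minimize $M\lambda+\sum_i h_i$ over $\lambda,h_i,p_i,\phi^i_{st}\ge 0$ ($1\le t\le T$, $s\in\{g,b\}$) subject to $$\lambda+\phi^i_{st}\ge R^i_{st},\qquad th_i\ge -c_i-(1-u_{it})p_i+\sum_{l\le t}\phi^i_{gl},\qquad th_i\ge -c_i+v_{it}p_i+\sum_{l\le t}\phi^i_{bl},\qquad M\lambda=\sum_i h_i .$$ The corresponding primal is: maximize $\sum_i\sum_{t\le T}\bigl(r_i(u_{it}x^i_{gt}+v_{it}x^i_{bt})-c_i(z^i_{gt}+z^i_{bt})\bigr)$ over $x^i_{st},z^i_{st}\ge 0$ and $\omega\in\mathbb{R}$ subject to $$\sum_{i}\sum_{t\le T}(x^i_{gt}+x^i_{bt})\le M(1-\omega),\quad \sum_{t\le T} t(z^i_{gt}+z^i_{bt})\le 1+\omega,\quad x^i_{st}\le\sum_{t\le l\le T}z^i_{sl},\quad \sum_{t\le T}(1-u_{it})z^i_{gt}=\sum_{t\le T}v_{it}z^i_{bt}.$$ **Policy.** Given optimal solutions of both programs, let $S=\{i: h_i>0\}$ and, for $i\in S$, $d_i=\min\{t: z^i_{bt}>0\}$,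 $e_i=\min\{t: z^i_{gt}>0\}$ and $m_i=|\{l\le d_i:\phi^i_{bl}>0\}|$. Only arms in $S$ are used. An arm observed in state $b$ is not ready for $d_i-m_i$ steps and ready afterwards. *Stage 1 (try)*, for a ready arm: play it for $m_i$ steps and probe it at the end of the last of them (if $m_i=0$, probe it at once, at the end of the time step just completed); if the state is $g$, go to Stage 2. *Stage 2 (exploit)*, for an arm just observed in state $g$: play it for $e_i$ steps and probe it at the end of the last of them; if the state is $g$, repeat Stage 2. The policy keeps initiating Stage 1 with ready arms, in any order, as long as fewer than $M$ arms are in the two stages. It starts from any observed states in which at most $M$ arms of $S$ are in state $g$ (these start in Stage 2). **Theorem.** For every instance and every $\epsilon>0$ there is $T_0$ such that for every $T\ge T_0$: both programs with horizon $T$ have optimal solutions; for all such optimal solutions the parameters $d_i,e_i$ ($i\in S$) are well defined and the policy can be executed; and every execution of the policy has time-average value (as a lower limit) at least $OPT/(2+\epsilon)$, where $OPT<\infty$. That is, the policy is a $(2+\epsilon)$-approximation to Feedback MAB with observation costs. -/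

import Mathlib

open Filter Finset

noncomputable section

/-- An instance with `n` independent two-state arms (`true` is the good state `g`, `false` the bad
state `b`).  An arm moves from `b` to `g` with probability `α` and from `g` to `b` with probability
`β`, whether or not it is played; `r` is the reward of a play in state `g` (a play in state `b`
earns nothing) and `c` is the cost of a probe. -/
structure ProbeBandit (n : ℕ) where
  α : Fin n → ℝ
  β : Fin n → ℝ
  r : Fin n → ℝ
  c : Fin n → ℝ
  α_pos : ∀ i, 0 < α i
  β_pos : ∀ i, 0 < β i
  bursty : ∀ i, α i + β i < 1
  r_nonneg : ∀ i, 0 ≤ r i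
  c_nonneg : ∀ i, 0 ≤ c i

/-- What the player can see: the set of arms that was played in a time step (nothing is revealed
about their rewards or states), and the outcome of a probe. -/
inductive Event (n : ℕ) where
  | played (A : Finset (Fin n)) : Event n
  | probed (i : Fin n) (good : Bool) : Event n

/-- Histories list the events, the most recent one first. -/
abbrev History (n : ℕ) := List (Event n)

/-- A (randomized, history dependent) policy that plays at most `M` arms per time step.
`play` chooses the arms played in a time step.  At the end of the time step the player probes arms
one after the other: `probe` chooses the next arm to probe, or `none` to finish the time step. -/
structure Policy (n M : ℕ) where
  play : History n → PMF (Finset (Fin n))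
  probe : History n → PMF (Option (Fin n))
  card_le : ∀ h, ∀ A ∈ (play h).support, A.card ≤ M

namespace ProbeBandit

variable {n : ℕ} (I : ProbeBandit n)

/-! ### The decision problem -/

/-- One-step transition probability of the joint hidden state; the arms are independent. -/
def trans (s s' : Fin n → Bool) : ℝ :=
  ∏ i, match s i, s' i with
    | false, true => I.α i
    | false, false => 1 - I.α i
    | true, false => I.β i
    | true, true => 1 - I.β i

/-- Expected value collected from the probing part of a time step on, when the hidden state during
the time step is `s`, the history is `h`, at most `k` further probes can be made in this time step,
and `cont` is the value collected after the time step. -/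
def probeValue {M : ℕ} (π : Policy n M) (s : Fin n → Bool) (cont : History n → ℝ) :
    ℕ → History n → ℝ
  | 0, h => cont h
  | k + 1, h => ∑ o : Option (Fin n), (π.probe h o).toReal *
      match o with
      | none => cont h
      | some i => -I.c i + probeValue π s cont k (Event.probed i (s i) :: h)

/-- Expected value (rewards minus probing costs) of the next `k` time steps, when the history is
`h` and the hidden state at the start of the next time step is `s`.  In a time step with hidden
state `s` the player plays, then makes up to `n` probes (enough to probe each arm once), which
reveal `s`; then the hidden state evolves. -/
def valueToGo {M : ℕ} (π : Policy n M) : ℕ → History n → (Fin n → Bool) → ℝ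
  | 0, _, _ => 0
  | k + 1, h, s => ∑ A : Finset (Fin n), (π.play h A).toReal *
      ((∑ i ∈ A, if s i then I.r i else 0) +
        I.probeValue π s (fun h' => ∑ s', I.trans s s' * valueToGo π k h' s') n
          (Event.played A :: h))

/-- Expected time-average value of the first `k` time steps, when the arms were all observed, in
the states `s₀`, at the end of the time step before the first one. -/
def averageValue {M : ℕ} (π : Policy n M) (s₀ : Fin n → Bool) (k : ℕ) : ℝ :=
  (∑ s, I.trans s₀ s * I.valueToGo π k [] s) / k

/-- Long-run time-average values, over all policies and all start states (upper limits). -/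
def achievableValues (M : ℕ) : Set ℝ :=
  {w | ∃ (π : Policy n M) (s₀ : Fin n → Bool), w = limsup (I.averageValue π s₀) atTop}

/-- The value of the optimal policy. -/
def optimalValue (M : ℕ) : ℝ := sSup (I.achievableValues M)

/-- The long-run time-average value that a policy guarantees (lower limit). -/
def guaranteedValue {M : ℕ} (π : Policy n M) (s₀ : Fin n → Bool) : ℝ :=
  liminf (I.averageValue π s₀) atTop

/-! ### The balanced linear program and its dual -/

/-- Probability that arm `i` is good when it was observed to be bad `t` steps ago. -/
def v (i : Fin n) (t : ℕ) : ℝ :=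
  I.α i / (I.α i + I.β i) * (1 - (1 - I.α i - I.β i) ^ t)

/-- Probability that arm `i` is good when it was observed to be good `t` steps ago. -/
def u (i : Fin n) (t : ℕ) : ℝ :=
  I.α i / (I.α i + I.β i) + I.β i / (I.α i + I.β i) * (1 - I.α i - I.β i) ^ t

/-- Expected reward of playing arm `i` when it was observed in state `s` exactly `t` steps ago. -/
def R (i : Fin n) (s : Bool) (t : ℕ) : ℝ :=
  I.r i * (if s then I.u i t else I.v i t)

/-- Variables of the balanced dual; only the `φ i s t` with `1 ≤ t ≤ T` matter. -/
structure DualPoint (n : ℕ) where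
  lam : ℝ
  h : Fin n → ℝ
  p : Fin n → ℝ
  φ : Fin n → Bool → ℕ → ℝ

/-- Variables of the balanced primal; only the entries with `1 ≤ t ≤ T` matter.  `ω` is the
multiplier of the balance constraint of the dual. -/
structure PrimalPoint (n : ℕ) where
  x : Fin n → Bool → ℕ → ℝ
  z : Fin n → Bool → ℕ → ℝ
  ω : ℝ

/-- Feasibility in the balanced dual with times restricted to `1 ≤ t ≤ T`. -/
structure DualFeasible (M T : ℕ) (D : DualPoint n) : Prop where
  lam_nonneg : 0 ≤ D.lam
  h_nonneg : ∀ i, 0 ≤ D.h i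
  p_nonneg : ∀ i, 0 ≤ D.p i
  φ_nonneg : ∀ i s, ∀ t ∈ Icc 1 T, 0 ≤ D.φ i s t
  play : ∀ i s, ∀ t ∈ Icc 1 T, I.R i s t ≤ D.lam + D.φ i s t
  good : ∀ i, ∀ t ∈ Icc 1 T,
    -I.c i - (1 - I.u i t) * D.p i + ∑ l ∈ Icc 1 t, D.φ i true l ≤ t * D.h i
  bad : ∀ i, ∀ t ∈ Icc 1 T,
    -I.c i + I.v i t * D.p i + ∑ l ∈ Icc 1 t, D.φ i false l ≤ t * D.h i
  balance : M * D.lam = ∑ i, D.h i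

def dualObjective (M : ℕ) (D : DualPoint n) : ℝ := M * D.lam + ∑ i, D.h i

def DualOptimal (M T : ℕ) (D : DualPoint n) : Prop :=
  I.DualFeasible M T D ∧
    ∀ D', I.DualFeasible M T D' → dualObjective M D ≤ dualObjective M D'

/-- Feasibility in the balanced primal with times restricted to `1 ≤ t ≤ T`. -/
structure PrimalFeasible (M T : ℕ) (P : PrimalPoint n) : Prop where
  x_nonneg : ∀ i s, ∀ t ∈ Icc 1 T, 0 ≤ P.x i s t
  z_nonneg : ∀ i s, ∀ t ∈ Icc 1 T, 0 ≤ P.z i s t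
  plays : ∑ i, ∑ t ∈ Icc 1 T, (P.x i true t + P.x i false t) ≤ M * (1 - P.ω)
  time : ∀ i, ∑ t ∈ Icc 1 T, t * (P.z i true t + P.z i false t) ≤ 1 + P.ω
  play_le : ∀ i s, ∀ t ∈ Icc 1 T, P.x i s t ≤ ∑ l ∈ Icc t T, P.z i s l
  flow : ∀ i, ∑ t ∈ Icc 1 T, (1 - I.u i t) * P.z i true t =
    ∑ t ∈ Icc 1 T, I.v i t * P.z i false t

def primalObjective (T : ℕ) (P : PrimalPoint n) : ℝ :=
  ∑ i, ∑ t ∈ Icc 1 T, (I.r i * (I.u i t * P.x i true t + I.v i t * P.x i false t) -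
    I.c i * (P.z i true t + P.z i false t))

def PrimalOptimal (M T : ℕ) (P : PrimalPoint n) : Prop :=
  I.PrimalFeasible M T P ∧
    ∀ P', I.PrimalFeasible M T P' → I.primalObjective T P' ≤ I.primalObjective T P

end ProbeBandit

/-! ### The two-stage policy -/

/-- The parameters of the policy: the arms `S` that it uses and, for each arm, `d`, `e` and `m`. -/
structure StageParams (n : ℕ) where
  S : Finset (Fin n)
  d : Fin n → ℕ
  e : Fin n → ℕ
  m : Fin n → ℕ

/-- The parameters that a primal and a dual solution define: `S` is the set of arms with `h i > 0`,
`d i` and `e i` are the smallest times `t` with `z i false t > 0` and `z i true t > 0`, and `m i`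
is the number of times `l ≤ d i` with `φ i false l > 0`. -/
def stageParams {n : ℕ} (T : ℕ) (P : ProbeBandit.PrimalPoint n) (D : ProbeBandit.DualPoint n) :
    StageParams n where
  S := {i | 0 < D.h i}
  d i := sInf {t | t ∈ Icc 1 T ∧ 0 < P.z i false t}
  e i := sInf {t | t ∈ Icc 1 T ∧ 0 < P.z i true t}
  m i := #{l ∈ Icc 1 (sInf {t | t ∈ Icc 1 T ∧ 0 < P.z i false t}) | 0 < D.φ i false l}

/-- The situation of an arm in the policy: `waiting y` means that it is in neither stage and `y`
time steps have passed since it was observed to be bad; `trying j` (`exploiting j`) means that it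
is in Stage 1 (Stage 2) and has been played `j` times in this stage. -/
inductive Phase where
  | waiting (y : ℕ) : Phase
  | trying (j : ℕ) : Phase
  | exploiting (j : ℕ) : Phase

/-- The phase of an arm after a history.  An arm in a stage is played in every time step until it
is probed, so that a play increases the counter. -/
def phase {n : ℕ} (s₀ : Fin n → Bool) : History n → Fin n → Phase
  | [], i => if s₀ i then .exploiting 0 else .waiting 0
  | .played A :: h, i =>
    match phase s₀ h i with
    | .waiting y => if i ∈ A then .trying 1 else .waiting (y + 1)
    | .trying j => .trying (j + 1)
    | .exploiting j => .exploiting (j + 1)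
  | .probed a good :: h, i =>
    if i = a then (if good then .exploiting 0 else .waiting 0) else phase s₀ h i

namespace StageParams

variable {n : ℕ} (q : StageParams n) (s₀ : Fin n → Bool)

open Classical in
/-- The arms that are in Stage 1 or Stage 2. -/
def busy (h : History n) : Finset (Fin n) :=
  {i ∈ q.S | ∃ j, phase s₀ h i = .trying j ∨ phase s₀ h i = .exploiting j}

open Classical in
/-- The arms in neither stage that are ready: `d - m` steps have passed since they were observed
to be bad. -/
def ready (h : History n) : Finset (Fin n) :=
  {i ∈ q.S | ∃ y, phase s₀ h i = .waiting y ∧ q.d i - q.m i ≤ y}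

/-- Arm `i` has completed the plays of its stage, so that it has to be probed now. -/
def Due (h : History n) (i : Fin n) : Prop :=
  i ∈ q.S ∧ (phase s₀ h i = .trying (q.m i) ∨ phase s₀ h i = .exploiting (q.e i))

/-- Choice of the arms to play in a time step: all the arms in a stage, and ready arms for which
Stage 1 starts with a play (arms with `m i > 0`).  If fewer than `M` arms are played, no ready arm
is left over. -/
def PlayRule (M : ℕ) (h : History n) (A : Finset (Fin n)) : Prop :=
  q.busy s₀ h ⊆ A ∧
  (∀ i ∈ A, i ∉ q.busy s₀ h → i ∈ q.ready s₀ h ∧ 0 < q.m i) ∧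
  (A.card < M → q.ready s₀ h ⊆ A)

/-- Choice of the next probe at the end of a time step.  An arm is probed if it is due, or if it is
ready, `m i = 0`, and fewer than `M` arms are in a stage: Stage 1 of such an arm consists of the
probe alone.  The time step can end when no arm is due. -/
def ProbeRule (M : ℕ) (h : History n) : Option (Fin n) → Prop
  | some i => q.Due s₀ h i ∨ (i ∈ q.ready s₀ h ∧ q.m i = 0 ∧ (q.busy s₀ h).card < M)
  | none => ∀ i, ¬ q.Due s₀ h i

end StageParams

/-- Decision points that a policy can reach: `Visits π none h` if it can have to choose the plays of
a time step with history `h`, and `Visits π (some k) h` if it can be at the end of a time step with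
history `h` and `k` probes left. -/
inductive Visits {n M : ℕ} (π : Policy n M) : Option ℕ → History n → Prop
  | start : Visits π none []
  | play {h : History n} {A : Finset (Fin n)} :
      Visits π none h → A ∈ (π.play h).support → Visits π (some n) (.played A :: h)
  | probe {k : ℕ} {h : History n} {i : Fin n} (good : Bool) :
      Visits π (some (k + 1)) h → some i ∈ (π.probe h).support →
        Visits π (some k) (.probed i good :: h)
  | finish {k : ℕ} {h : History n} :
      Visits π (some (k + 1)) h → none ∈ (π.probe h).support → Visits π none h
  | last {h : History n} : Visits π (some 0) h → Visits π none h

/-- `π` is an execution of the two-stage policy with parameters `q`: all its decisions obey the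
rules.  Which ready arms get the free places is left open. -/
def IsTwoStage {n M : ℕ} (q : StageParams n) (s₀ : Fin n → Bool) (π : Policy n M) : Prop :=
  (∀ h, Visits π none h → ∀ A ∈ (π.play h).support, q.PlayRule s₀ M h A) ∧
  (∀ k h, Visits π (some (k + 1)) h → ∀ o ∈ (π.probe h).support, q.ProbeRule s₀ M h o)

end

/-! Read λ as the price of one play and h_i as the price of one time step of arm i. A feasible dual
point bounds every policy from above (`expValue_le`). Give an arm observed t steps ago the potential
t h_i, plus p_i if it was seen good, minus the excesses max(0, R − λ) of those t steps. The probe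
constraints say that a probe never raises expected potential minus cost, and in a time step reward
plus change of potential is at most Mλ + Σ h_i. Constraints up to the horizon T extend to all times
when h_i grows by (c_i + p_i)/T (`DualFeasible.extend`). Balance turns Mλ + Σ h_i into 2Mλ, so OPT
is at most 2Mλ up to an error that vanishes as T grows (`exists_horizon`).

Conversely, the two-stage policy earns Mλ per step. Optimal solutions have equal values (Farkas,
`exists_primal_ge`), so complementary slackness holds. It makes the probe constraints tight at d_i
and e_i and shows that the positive excesses before d_i are those of the last m_i steps
(`tightStages`). With the potential `stageValue` a probe then loses nothing in expectation, while a
time step brings at least λ for each played arm and h_i for each arm of S that is not both ready and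
idle. If M arms are played this gives Mλ. If fewer are played, no ready arm is idle and the total is
at least Σ h_i, again Mλ by balance (`le_expValue_of_isTwoStage`). This dichotomy is the reason for
the balance constraint. -/

noncomputable section

/-! ### Farkas' lemma -/

/-- **Farkas' lemma** for finitely many linear functionals on an arbitrary real vector space. -/
theorem farkas {V J : Type*} [AddCommGroup V] [Module ℝ V] (s : Finset J) :
    ∀ (a : J → V →ₗ[ℝ] ℝ) (c : V →ₗ[ℝ] ℝ), (∀ x, (∀ j ∈ s, 0 ≤ a j x) → 0 ≤ c x) →
      ∃ w : J → ℝ, (∀ j, 0 ≤ w j) ∧ ∀ x, c x = ∑ j ∈ s, w j * a j x := by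
  classical
  induction s using Finset.induction_on with
  | empty =>
    intro a c h
    refine ⟨fun _ => 0, fun _ => le_rfl, fun x => ?_⟩
    have h1 := h x (by simp)
    have h2 := h (-x) (by simp)
    rw [map_neg] at h2
    simp only [sum_empty]
    linarith
  | insert k s hk ih =>
    intro a c h
    -- Either the constraint `k` is redundant, or some `z` satisfies the others with `c z < 0`, and
    -- then `a k z < 0`.
    by_cases hA : ∀ x, (∀ j ∈ s, 0 ≤ a j x) → 0 ≤ c x
    · obtain ⟨w, hw, hc⟩ := ih a c hA
      refine ⟨Function.update w k 0, fun j => ?_, fun x => ?_⟩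
      · by_cases hj : j = k
        · subst hj; simp
        · simp [hj, hw j]
      · rw [sum_insert hk, hc x]
        simp only [Function.update_self, zero_mul, zero_add]
        refine sum_congr rfl fun j hj => ?_
        rw [Function.update_of_ne (by rintro rfl; exact hk hj)]
    · push Not at hA
      obtain ⟨z, hz, hcz⟩ := hA
      have hb : a k z < 0 := by
        by_contra hb
        push Not at hb
        have := h z fun j hj => by
          rcases mem_insert.1 hj with rfl | hj
          · exact hb
          · exact hz j hj
        linarith
      -- These functionals are the old ones composed with the projection onto the kernel of `a k`
      -- along `z`. On that kernel the constraint `k` is void, so the induction hypothesis applies.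
      obtain ⟨w, hw, hc⟩ := ih (fun j => a j - (a j z / a k z) • a k)
        (c - (c z / a k z) • a k) (by
          intro x hx
          have key : ∀ f : V →ₗ[ℝ] ℝ, f (x - (a k x / a k z) • z) =
              f x - f z / a k z * a k x := by
            intro f
            simp only [map_sub, map_smul, smul_eq_mul]
            ring
          have := h (x - (a k x / a k z) • z) (by
            intro j hj
            rw [key]
            rcases mem_insert.1 hj with rfl | hj
            · rw [div_self hb.ne]; simp
            · simpa using hx j hj)
          rw [key] at this
          simpa using this)
      have hpos : 0 ≤ (c z - ∑ j ∈ s, w j * a j z) / a k z := by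
        refine div_nonneg_of_nonpos ?_ hb.le
        have : 0 ≤ ∑ j ∈ s, w j * a j z := sum_nonneg fun j hj => mul_nonneg (hw j) (hz j hj)
        linarith
      refine ⟨Function.update w k ((c z - ∑ j ∈ s, w j * a j z) / a k z), fun j => ?_,
        fun x => ?_⟩
      · by_cases hj : j = k
        · subst hj; simpa using hpos
        · simp [hj, hw j]
      · rw [sum_insert hk]
        have h1 : ∑ j ∈ s, Function.update w k ((c z - ∑ j ∈ s, w j * a j z) / a k z) j * a j x
            = ∑ j ∈ s, w j * a j x := by
          refine sum_congr rfl fun j hj => ?_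
          rw [Function.update_of_ne (by rintro rfl; exact hk hj)]
        have h2 := hc x
        simp only [LinearMap.sub_apply, LinearMap.smul_apply, smul_eq_mul, mul_sub,
          sum_sub_distrib] at h2
        have h3 : ∑ j ∈ s, w j * (a j z / a k z * a k x) =
            (∑ j ∈ s, w j * a j z) / a k z * a k x := by
          rw [sum_div, sum_mul]
          exact sum_congr rfl fun j _ => by ring
        rw [h1, Function.update_self]
        rw [h3] at h2
        rw [sub_div, sub_mul]
        linarith

/-- Affine form of Farkas' lemma: a linear inequality that follows from a solvable finite system of
linear inequalities is a nonnegative combination of it. -/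
theorem affine_farkas {V J : Type*} [AddCommGroup V] [Module ℝ V] (s : Finset J)
    (a : J → V →ₗ[ℝ] ℝ) (b : J → ℝ) (f : V →ₗ[ℝ] ℝ) (d : ℝ) (y₀ : V)
    (hy₀ : ∀ j ∈ s, b j ≤ a j y₀) (h : ∀ y, (∀ j ∈ s, b j ≤ a j y) → d ≤ f y) :
    ∃ w : J → ℝ, (∀ j, 0 ≤ w j) ∧ (∀ y, f y = ∑ j ∈ s, w j * a j y) ∧
      d ≤ ∑ j ∈ s, w j * b j := by
  let τ : V × ℝ →ₗ[ℝ] ℝ := LinearMap.snd ℝ V ℝ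
  -- Homogenization: an extra coordinate `t` multiplies the constants, and the index `none` stands
  -- for `0 ≤ t`. Points with `t > 0` are rescaled to `t = 1`; those with `t = 0` are recession
  -- directions.
  obtain ⟨w, hw, hf⟩ := farkas (insertNone s)
    (fun o => o.elim τ fun j => a j ∘ₗ LinearMap.fst ℝ V ℝ - b j • τ)
    (f ∘ₗ LinearMap.fst ℝ V ℝ - d • τ) (by
      rintro ⟨y, t⟩ hy
      have ht : 0 ≤ t := hy none (by simp)
      have hj : ∀ j ∈ s, b j * t ≤ a j y := fun j hj => by
        have := hy (some j) (by simpa using hj)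
        simpa [τ] using this
      suffices d * t ≤ f y by simpa [τ] using this
      rcases ht.eq_or_lt with rfl | ht
      · rw [mul_zero]
        by_contra hneg
        push Not at hneg
        -- The step length is chosen so that `f` falls to `d - 1` at the new point, which is still
        -- feasible.
        have key := h (y₀ + ((f y₀ - d + 1) / (-f y)) • y) fun j hj' => by
          have h0 : 0 ≤ (f y₀ - d + 1) / (-f y) := by
            have := h y₀ hy₀
            apply div_nonneg <;> linarith
          have h1 := hj j hj'
          rw [mul_zero] at h1
          have h2 := hy₀ j hj'
          have h3 := mul_nonneg h0 h1
          simp only [map_add, map_smul, smul_eq_mul]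
          linarith
        have h4 : (f y₀ - d + 1) / (-f y) * f y = -(f y₀ - d + 1) := by
          have hne : f y ≠ 0 := hneg.ne
          field_simp
        simp only [map_add, map_smul, smul_eq_mul, h4] at key
        linarith
      · have := h (t⁻¹ • y) fun j hj' => by
          have := hj j hj'
          rw [map_smul, smul_eq_mul, ← div_eq_inv_mul, le_div_iff₀ ht]
          exact this
        rw [map_smul, smul_eq_mul, ← div_eq_inv_mul, le_div_iff₀ ht] at this
        exact this)
  refine ⟨fun j => w (some j), fun j => hw _, fun y => ?_, ?_⟩
  · have := hf (y, 0)
    simpa [τ] using this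
  · have := hf (0, 1)
    have h0 := hw none
    simp [τ] at this
    linarith
-- Monotonicity of beliefs and rewards
namespace ProbeBandit
variable {n : ℕ} (I : ProbeBandit n)

theorem rho_pos (i : Fin n) : 0 < 1 - I.α i - I.β i := by linarith [I.bursty i]

theorem rho_lt_one (i : Fin n) : 1 - I.α i - I.β i < 1 := by
  linarith [I.α_pos i, I.β_pos i]

theorem rate_pos (i : Fin n) : 0 < I.α i + I.β i := add_pos (I.α_pos i) (I.β_pos i)

theorem v_mono (i : Fin n) : Monotone (I.v i) := by
  intro t t' h
  have := pow_le_pow_of_le_one (I.rho_pos i).le (I.rho_lt_one i).le h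
  exact mul_le_mul_of_nonneg_left (by linarith) (div_nonneg (I.α_pos i).le (I.rate_pos i).le)

theorem u_anti (i : Fin n) : Antitone (I.u i) := by
  intro t t' h
  have := pow_le_pow_of_le_one (I.rho_pos i).le (I.rho_lt_one i).le h
  have := mul_le_mul_of_nonneg_left this (div_nonneg (I.β_pos i).le (I.rate_pos i).le)
  unfold u
  linarith

theorem v_zero (i : Fin n) : I.v i 0 = 0 := by simp [v]

theorem u_zero (i : Fin n) : I.u i 0 = 1 := by
  have := (I.rate_pos i).ne'
  simp only [u, pow_zero, mul_one]
  field_simp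

theorem v_one (i : Fin n) : I.v i 1 = I.α i := by
  have := (I.rate_pos i).ne'
  simp only [v, pow_one]
  field_simp
  ring

theorem u_one (i : Fin n) : I.u i 1 = 1 - I.β i := by
  have := (I.rate_pos i).ne'
  simp only [u, pow_one]
  field_simp
  ring

theorem v_nonneg (i : Fin n) (t : ℕ) : 0 ≤ I.v i t :=
  (I.v_zero i).symm.le.trans (I.v_mono i (Nat.zero_le t))

theorem v_pos (i : Fin n) {t : ℕ} (ht : 1 ≤ t) : 0 < I.v i t :=
  (I.α_pos i).trans_le ((I.v_one i).symm.le.trans (I.v_mono i ht))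

theorem u_lt_one (i : Fin n) {t : ℕ} (ht : 1 ≤ t) : I.u i t < 1 := by
  have := I.u_anti i ht
  rw [u_one] at this
  linarith [I.β_pos i]

theorem u_le_one (i : Fin n) (t : ℕ) : I.u i t ≤ 1 :=
  (I.u_anti i (Nat.zero_le t)).trans (I.u_zero i).le

/-- Since α + β < 1, the powers in `u` and `v` stay positive: `v` remains below the stationary
probability and `u` above it, at all times. -/
theorem v_le_u (i : Fin n) (t t' : ℕ) : I.v i t ≤ I.u i t' := by
  have h1 := pow_pos (I.rho_pos i) t
  have h2 := pow_pos (I.rho_pos i) t'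
  have h3 := div_pos (I.α_pos i) (I.rate_pos i)
  have h4 := div_pos (I.β_pos i) (I.rate_pos i)
  unfold u v
  nlinarith [mul_pos h3 h1, mul_pos h4 h2]

theorem u_nonneg (i : Fin n) (t : ℕ) : 0 ≤ I.u i t := (I.v_nonneg i 0).trans (I.v_le_u i 0 t)

theorem v_le_one (i : Fin n) (t : ℕ) : I.v i t ≤ 1 := (I.v_le_u i t 0).trans (I.u_le_one i 0)

theorem R_true (i : Fin n) (t : ℕ) : I.R i true t = I.r i * I.u i t := by simp [R]

theorem R_false (i : Fin n) (t : ℕ) : I.R i false t = I.r i * I.v i t := by simp [R]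

theorem R_true_anti (i : Fin n) : Antitone (I.R i true) := fun t t' h => by
  rw [R_true, R_true]
  exact mul_le_mul_of_nonneg_left (I.u_anti i h) (I.r_nonneg i)

theorem R_false_mono (i : Fin n) : Monotone (I.R i false) := fun t t' h => by
  rw [R_false, R_false]
  exact mul_le_mul_of_nonneg_left (I.v_mono i h) (I.r_nonneg i)

theorem R_false_le_true (i : Fin n) (t t' : ℕ) : I.R i false t ≤ I.R i true t' := by
  rw [R_false, R_true]
  exact mul_le_mul_of_nonneg_left (I.v_le_u i t t') (I.r_nonneg i)

theorem R_le (i : Fin n) (s : Bool) (t : ℕ) : I.R i s t ≤ I.r i := by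
  cases s
  · rw [R_false]; exact mul_le_of_le_one_right (I.r_nonneg i) (I.v_le_one i t)
  · rw [R_true]; exact mul_le_of_le_one_right (I.r_nonneg i) (I.u_le_one i t)

/-! ### Lagrangian identity and complementary slackness -/

/-- The coefficient of `p i` in the probe constraint for the last observation `s`. -/
def gain (i : Fin n) (s : Bool) (t : ℕ) : ℝ := if s then -(1 - I.u i t) else I.v i t

/-- The common form of the constraints `good` and `bad` of the dual. -/
def ProbeConstraint (D : DualPoint n) (i : Fin n) (s : Bool) (t : ℕ) : Prop :=
  -I.c i + I.gain i s t * D.p i + ∑ l ∈ Icc 1 t, D.φ i s l ≤ t * D.h i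

variable {I} {M T : ℕ}

theorem DualFeasible.probe {D : DualPoint n} (hD : I.DualFeasible M T D) (i : Fin n) (s : Bool)
    {t : ℕ} (ht : t ∈ Icc 1 T) : I.ProbeConstraint D i s t := by
  cases s
  · simpa [ProbeConstraint, gain] using hD.bad i t ht
  · have := hD.good i t ht
    simp only [ProbeConstraint, gain, if_true]
    linarith

variable (I M T) in
/-- The primal objective with the two observed states treated alike. -/
theorem primalObjective_eq (P : PrimalPoint n) : I.primalObjective T P =
    ∑ i, ∑ s, ∑ t ∈ Icc 1 T, (P.x i s t * I.R i s t - I.c i * P.z i s t) := by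
  unfold primalObjective
  refine sum_congr rfl fun i _ => ?_
  rw [Fintype.sum_bool, ← sum_add_distrib]
  refine sum_congr rfl fun t _ => ?_
  rw [R_true, R_false]
  ring

theorem PrimalFeasible.flow_gain {P : PrimalPoint n} (hP : I.PrimalFeasible M T P) (i : Fin n) :
    ∑ s, ∑ t ∈ Icc 1 T, P.z i s t * I.gain i s t = 0 := by
  have := hP.flow i
  rw [Fintype.sum_bool]
  simp only [gain, if_true, Bool.false_eq_true, if_false]
  simp only [mul_comm (P.z i _ _), neg_mul, sum_neg_distrib]
  linarith

/-- Pairs each `φ` at time `l` with the probes at times `t ≥ l`; this links the sums in the dual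
probe constraints to the tail sums in the primal. -/
theorem sum_mul_sum_Icc (T : ℕ) (f g : ℕ → ℝ) :
    ∑ t ∈ Icc 1 T, f t * ∑ l ∈ Icc 1 t, g l = ∑ l ∈ Icc 1 T, g l * ∑ t ∈ Icc l T, f t := by
  simp only [mul_sum]
  rw [sum_comm' (s' := fun l => Icc l T) (t' := Icc 1 T)
    (h := by intro x y; simp only [mem_Icc]; omega)]
  simp only [mul_comm]

/-- The Lagrangian identity: the duality gap is the sum of all the products of a multiplier and the
slack of its constraint. -/
theorem duality_gap (P : PrimalPoint n) (D : DualPoint n)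
    (hflow : ∀ i, ∑ s, ∑ t ∈ Icc 1 T, P.z i s t * I.gain i s t = 0)
    (hbal : M * D.lam = ∑ i, D.h i) :
    dualObjective M D - I.primalObjective T P =
      D.lam * (M * (1 - P.ω) - ∑ i, ∑ s, ∑ t ∈ Icc 1 T, P.x i s t) +
      ∑ i, D.h i * (1 + P.ω - ∑ s, ∑ t ∈ Icc 1 T, t * P.z i s t) +
      (∑ i, ∑ s, ∑ t ∈ Icc 1 T, P.x i s t * (D.lam + D.φ i s t - I.R i s t)) +
      (∑ i, ∑ s, ∑ t ∈ Icc 1 T, D.φ i s t * (∑ l ∈ Icc t T, P.z i s l - P.x i s t)) +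
      ∑ i, ∑ s, ∑ t ∈ Icc 1 T, P.z i s t * (t * D.h i -
        (-I.c i + I.gain i s t * D.p i + ∑ l ∈ Icc 1 t, D.φ i s l)) := by
  rw [primalObjective_eq, dualObjective]
  have h1 : ∀ i, ∑ s, ∑ t ∈ Icc 1 T, P.z i s t * (t * D.h i -
        (-I.c i + I.gain i s t * D.p i + ∑ l ∈ Icc 1 t, D.φ i s l)) =
      D.h i * ∑ s, ∑ t ∈ Icc 1 T, t * P.z i s t + I.c i * ∑ s, ∑ t ∈ Icc 1 T, P.z i s t
      - ∑ s, ∑ t ∈ Icc 1 T, D.φ i s t * ∑ l ∈ Icc t T, P.z i s l := by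
    intro i
    have e : ∑ s, ∑ t ∈ Icc 1 T, D.φ i s t * ∑ l ∈ Icc t T, P.z i s l =
        ∑ s, ∑ t ∈ Icc 1 T, P.z i s t * ∑ l ∈ Icc 1 t, D.φ i s l :=
      sum_congr rfl fun s _ => (sum_mul_sum_Icc T _ _).symm
    -- Flow conservation removes `p` from the identity.
    have hf : ∑ s, ∑ t ∈ Icc 1 T, P.z i s t * (I.gain i s t * D.p i) = 0 := by
      have := congrArg (· * D.p i) (hflow i)
      simpa only [sum_mul, zero_mul, mul_assoc] using this
    rw [e]
    simp only [mul_sub, mul_add, sum_sub_distrib, sum_add_distrib, hf]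
    simp only [mul_sum]
    have e1 : ∀ s, ∑ t ∈ Icc 1 T, P.z i s t * -I.c i = - ∑ t ∈ Icc 1 T, I.c i * P.z i s t := by
      intro s; rw [← sum_neg_distrib]; exact sum_congr rfl fun t _ => by ring
    have e2 : ∀ s, ∑ t ∈ Icc 1 T, P.z i s t * (t * D.h i) =
        ∑ t ∈ Icc 1 T, D.h i * (t * P.z i s t) := by
      intro s; exact sum_congr rfl fun t _ => by ring
    simp only [e1, e2, sum_neg_distrib]
    ring
  simp only [h1]
  simp only [mul_sub, mul_add, sum_sub_distrib, sum_add_distrib, mul_one]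
  simp only [← sum_mul, ← mul_sum]
  have e3 : ∑ i, ∑ s, ∑ t ∈ Icc 1 T, P.x i s t * D.φ i s t =
      ∑ i, ∑ s, ∑ t ∈ Icc 1 T, D.φ i s t * P.x i s t := by simp only [mul_comm]
  -- By balance the two contributions of `ω` cancel.
  rw [e3, ← hbal]
  ring

end ProbeBandit
namespace ProbeBandit
variable {n : ℕ} {I : ProbeBandit n} {M T : ℕ}

/-- The products in `duality_gap` are nonnegative for feasible points. -/
theorem weak_duality {P : PrimalPoint n} {D : DualPoint n} (hP : I.PrimalFeasible M T P)
    (hD : I.DualFeasible M T D) : I.primalObjective T P ≤ dualObjective M D := by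
  have h := duality_gap P D hP.flow_gain hD.balance
  have h1 : 0 ≤ M * (1 - P.ω) - ∑ i, ∑ s, ∑ t ∈ Icc 1 T, P.x i s t := by
    have := hP.plays
    simp only [Fintype.sum_bool, ← sum_add_distrib]
    linarith
  have h2 : ∀ i, 0 ≤ 1 + P.ω - ∑ s, ∑ t ∈ Icc 1 T, t * P.z i s t := by
    intro i
    have := hP.time i
    simp only [Fintype.sum_bool, ← sum_add_distrib, ← mul_add]
    linarith
  have h3 := mul_nonneg hD.lam_nonneg h1
  have h4 : 0 ≤ ∑ i, D.h i * (1 + P.ω - ∑ s, ∑ t ∈ Icc 1 T, t * P.z i s t) :=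
    sum_nonneg fun i _ => mul_nonneg (hD.h_nonneg i) (h2 i)
  have h5 : 0 ≤ ∑ i, ∑ s, ∑ t ∈ Icc 1 T, P.x i s t * (D.lam + D.φ i s t - I.R i s t) :=
    sum_nonneg fun i _ => sum_nonneg fun s _ => sum_nonneg fun t ht =>
      mul_nonneg (hP.x_nonneg i s t ht) (sub_nonneg.2 (hD.play i s t ht))
  have h6 : 0 ≤ ∑ i, ∑ s, ∑ t ∈ Icc 1 T, D.φ i s t * (∑ l ∈ Icc t T, P.z i s l - P.x i s t) :=
    sum_nonneg fun i _ => sum_nonneg fun s _ => sum_nonneg fun t ht =>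
      mul_nonneg (hD.φ_nonneg i s t ht) (sub_nonneg.2 (hP.play_le i s t ht))
  have h7 : 0 ≤ ∑ i, ∑ s, ∑ t ∈ Icc 1 T, P.z i s t * (t * D.h i -
        (-I.c i + I.gain i s t * D.p i + ∑ l ∈ Icc 1 t, D.φ i s l)) :=
    sum_nonneg fun i _ => sum_nonneg fun s _ => sum_nonneg fun t ht =>
      mul_nonneg (hP.z_nonneg i s t ht) (sub_nonneg.2 (hD.probe i s ht))
  linarith

/-- Complementary slackness. -/
structure Slack (I : ProbeBandit n) (T : ℕ) (P : PrimalPoint n) (D : DualPoint n) : Prop where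
  time : ∀ i, D.h i ≠ 0 → ∑ s, ∑ t ∈ Icc 1 T, t * P.z i s t = 1 + P.ω
  play : ∀ i s, ∀ t ∈ Icc 1 T, P.x i s t ≠ 0 → D.lam + D.φ i s t = I.R i s t
  play_le : ∀ i s, ∀ t ∈ Icc 1 T, D.φ i s t ≠ 0 → P.x i s t = ∑ l ∈ Icc t T, P.z i s l
  probe : ∀ i s, ∀ t ∈ Icc 1 T, P.z i s t ≠ 0 →
    -I.c i + I.gain i s t * D.p i + ∑ l ∈ Icc 1 t, D.φ i s l = t * D.h i

/-- With a zero gap the nonnegative products of `duality_gap` sum to zero, so each of them vanishes.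
-/
theorem slack_of_eq {P : PrimalPoint n} {D : DualPoint n} (hP : I.PrimalFeasible M T P)
    (hD : I.DualFeasible M T D) (heq : I.primalObjective T P = dualObjective M D) :
    Slack I T P D := by
  have h := duality_gap P D hP.flow_gain hD.balance
  have h1 : 0 ≤ M * (1 - P.ω) - ∑ i, ∑ s, ∑ t ∈ Icc 1 T, P.x i s t := by
    have := hP.plays
    simp only [Fintype.sum_bool, ← sum_add_distrib]
    linarith
  have h2 : ∀ i, 0 ≤ 1 + P.ω - ∑ s, ∑ t ∈ Icc 1 T, t * P.z i s t := by
    intro i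
    have := hP.time i
    simp only [Fintype.sum_bool, ← sum_add_distrib, ← mul_add]
    linarith
  have h3 := mul_nonneg hD.lam_nonneg h1
  have n4 : ∀ i, 0 ≤ D.h i * (1 + P.ω - ∑ s, ∑ t ∈ Icc 1 T, t * P.z i s t) :=
    fun i => mul_nonneg (hD.h_nonneg i) (h2 i)
  have n5 : ∀ i s, ∀ t ∈ Icc 1 T, 0 ≤ P.x i s t * (D.lam + D.φ i s t - I.R i s t) :=
    fun i s t ht => mul_nonneg (hP.x_nonneg i s t ht) (sub_nonneg.2 (hD.play i s t ht))
  have n6 : ∀ i s, ∀ t ∈ Icc 1 T, 0 ≤ D.φ i s t * (∑ l ∈ Icc t T, P.z i s l - P.x i s t) :=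
    fun i s t ht => mul_nonneg (hD.φ_nonneg i s t ht) (sub_nonneg.2 (hP.play_le i s t ht))
  have n7 : ∀ i s, ∀ t ∈ Icc 1 T, 0 ≤ P.z i s t * (t * D.h i -
        (-I.c i + I.gain i s t * D.p i + ∑ l ∈ Icc 1 t, D.φ i s l)) :=
    fun i s t ht => mul_nonneg (hP.z_nonneg i s t ht) (sub_nonneg.2 (hD.probe i s ht))
  have h4 := sum_nonneg fun i (_ : i ∈ univ) => n4 i
  have h5 := sum_nonneg fun i (_ : i ∈ univ) => sum_nonneg fun s (_ : s ∈ univ) =>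
    sum_nonneg (n5 i s)
  have h6 := sum_nonneg fun i (_ : i ∈ univ) => sum_nonneg fun s (_ : s ∈ univ) =>
    sum_nonneg (n6 i s)
  have h7 := sum_nonneg fun i (_ : i ∈ univ) => sum_nonneg fun s (_ : s ∈ univ) =>
    sum_nonneg (n7 i s)
  have zero3 : ∀ f : Fin n → Bool → ℕ → ℝ, (∀ i s, ∀ t ∈ Icc 1 T, 0 ≤ f i s t) →
      ∑ i, ∑ s, ∑ t ∈ Icc 1 T, f i s t ≤ 0 → ∀ i s, ∀ t ∈ Icc 1 T, f i s t = 0 := by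
    intro f hf h0 i s t ht
    have a1 := (sum_eq_zero_iff_of_nonneg fun i (_ : i ∈ univ) => sum_nonneg
      fun s (_ : s ∈ univ) => sum_nonneg (hf i s)).1 (le_antisymm h0 (sum_nonneg
        fun i _ => sum_nonneg fun s _ => sum_nonneg (hf i s))) i (mem_univ i)
    have a2 := (sum_eq_zero_iff_of_nonneg fun s (_ : s ∈ univ) => sum_nonneg (hf i s)).1 a1 s
      (mem_univ s)
    exact (sum_eq_zero_iff_of_nonneg (hf i s)).1 a2 t ht
  have z4 := (sum_eq_zero_iff_of_nonneg fun i (_ : i ∈ univ) => n4 i).1 (le_antisymm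
    (by linarith) h4)
  have z5 := zero3 _ n5 (by linarith)
  have z6 := zero3 _ n6 (by linarith)
  have z7 := zero3 _ n7 (by linarith)
  refine ⟨fun i hi => ?_, fun i s t ht hx => ?_, fun i s t ht hx => ?_, fun i s t ht hx => ?_⟩
  · have := (mul_eq_zero.1 (z4 i (mem_univ i))).resolve_left hi
    linarith
  · have := (mul_eq_zero.1 (z5 i s t ht)).resolve_left hx
    linarith
  · have := (mul_eq_zero.1 (z6 i s t ht)).resolve_left hx
    linarith
  · have := (mul_eq_zero.1 (z7 i s t ht)).resolve_left hx
    linarith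

/-! ### Strong duality -/

/-- Points of the dual without the sign constraint on `p` are turned into feasible points. -/
theorem dualFeasible_of_free {D : DualPoint n} (h1 : 0 ≤ D.lam) (h2 : ∀ i, 0 ≤ D.h i)
    (h3 : ∀ i s, ∀ t ∈ Icc 1 T, 0 ≤ D.φ i s t)
    (h4 : ∀ i s, ∀ t ∈ Icc 1 T, I.R i s t ≤ D.lam + D.φ i s t)
    (h5 : ∀ i s, ∀ t ∈ Icc 1 T, I.ProbeConstraint D i s t) (h6 : M * D.lam = ∑ i, D.h i) :
    I.DualFeasible M T ⟨D.lam, D.h, fun i => max 0 (D.p i),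
      fun i s t => max 0 (I.R i s t - D.lam)⟩ := by
  have hφ : ∀ i s, ∀ t ∈ Icc 1 T, ∑ l ∈ Icc 1 t, max 0 (I.R i s l - D.lam) ≤
      ∑ l ∈ Icc 1 t, D.φ i s l := by
    intro i s t ht
    refine sum_le_sum fun l hl => ?_
    have hl' : l ∈ Icc 1 T := by simp only [mem_Icc] at hl ht ⊢; omega
    exact max_le (h3 i s l hl') (by linarith [h4 i s l hl'])
  have hg : ∀ i, ∀ t ∈ Icc 1 T, -I.c i - (1 - I.u i t) * max 0 (D.p i) +
      ∑ l ∈ Icc 1 t, max 0 (I.R i true l - D.lam) ≤ t * D.h i ∧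
      -I.c i - (1 - I.u i t) * D.p i +
      ∑ l ∈ Icc 1 t, max 0 (I.R i true l - D.lam) ≤ t * D.h i := by
    intro i t ht
    have a := h5 i true t ht
    simp only [ProbeConstraint, gain, if_true] at a
    have b := hφ i true t ht
    have c := mul_le_mul_of_nonneg_left (le_max_right 0 (D.p i)) (sub_nonneg.2 (I.u_le_one i t))
    constructor <;> linarith
  refine ⟨h1, h2, fun i => le_max_left _ _, fun i s t _ => le_max_left _ _, fun i s t _ => ?_,
    fun i t ht => (hg i t ht).1, fun i t ht => ?_, h6⟩
  · have := le_max_right 0 (I.R i s t - D.lam)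
    show _ ≤ D.lam + max 0 (I.R i s t - D.lam)
    linarith
  · show -I.c i + I.v i t * max 0 (D.p i) + ∑ l ∈ Icc 1 t, max 0 (I.R i false l - D.lam) ≤ _
    rcases le_total 0 (D.p i) with hp | hp
    · rw [max_eq_right hp]
      have a := h5 i false t ht
      simp only [ProbeConstraint, gain] at a
      have b := hφ i false t ht
      simp at a
      linarith
    -- Raising a negative `p` to 0 tightens the bad constraint. It then follows from the good one,
    -- because rewards after a bad observation never exceed those after a good one. Hence the sign
    -- of `p` is no real restriction, which fits the flow equality of the primal.
    · rw [max_eq_left hp]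
      have a := (hg i t ht).1
      rw [max_eq_left hp] at a
      have b : ∑ l ∈ Icc 1 t, max 0 (I.R i false l - D.lam) ≤
          ∑ l ∈ Icc 1 t, max 0 (I.R i true l - D.lam) :=
        sum_le_sum fun l _ => max_le_max le_rfl (by linarith [I.R_false_le_true i l l])
      linarith

/-- Choosing `φ` as small as the play constraints allow costs nothing. This leaves finitely many
variables and defines the excesses beyond the horizon too. -/
theorem DualFeasible.reduced {D : DualPoint n} (hD : I.DualFeasible M T D) :
    I.DualFeasible M T ⟨D.lam, D.h, D.p, fun i s t => max 0 (I.R i s t - D.lam)⟩ := by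
  have := dualFeasible_of_free hD.lam_nonneg hD.h_nonneg hD.φ_nonneg hD.play
    (fun i s t ht => hD.probe i s ht) hD.balance
  have e : (fun i => max 0 (D.p i)) = D.p := funext fun i => max_eq_right (hD.p_nonneg i)
  rwa [e] at this

theorem exists_dualFeasible (I : ProbeBandit n) (hM : 1 ≤ M) (T : ℕ) :
    ∃ D, I.DualFeasible M T D := by
  have hr : ∀ i, I.r i ≤ ∑ j, I.r j := fun i =>
    single_le_sum (fun j _ => I.r_nonneg j) (mem_univ i)
  have h0 : 0 ≤ ∑ j, I.r j := sum_nonneg fun j _ => I.r_nonneg j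
  -- Without arms there is nothing to divide by. Otherwise λ = Σ r exceeds all rewards, so `φ` and
  -- `p` can be 0, and `h` is spread evenly to reach balance.
  rcases Nat.eq_zero_or_pos n with rfl | hn
  · exact ⟨⟨0, 0, 0, 0⟩, le_rfl, by simp, by simp, by simp, fun i => i.elim0, fun i => i.elim0,
      fun i => i.elim0, by simp⟩
  · have hn' : (0 : ℝ) < n := by exact_mod_cast hn
    refine ⟨⟨∑ j, I.r j, fun _ => M * (∑ j, I.r j) / n, 0, 0⟩, h0, fun i => by positivity,
      fun i => le_rfl, fun i s t _ => le_rfl, fun i s t _ => ?_, fun i t _ => ?_, fun i t _ => ?_,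
      ?_⟩
    · simpa using (I.R_le i s t).trans (hr i)
    · have : 0 ≤ (t : ℝ) * (M * (∑ j, I.r j) / n) := by positivity
      simp
      linarith [I.c_nonneg i]
    · have : 0 ≤ (t : ℝ) * (M * (∑ j, I.r j) / n) := by positivity
      simp
      linarith [I.c_nonneg i]
    · simp
      field_simp

/-- The bad constraint at time 1, where `v` is α. It controls `p`, which the objective does not see,
both for compactness and for the horizon error. -/
theorem DualFeasible.p_le {D : DualPoint n} (hD : I.DualFeasible M T D) (hT : 1 ≤ T) (i : Fin n) :
    D.p i ≤ (D.h i + I.c i) / I.α i := by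
  have h1 : 1 ∈ Icc 1 T := by simp [hT]
  have := hD.bad i 1 h1
  rw [v_one] at this
  simp only [Icc_self, sum_singleton, Nat.cast_one, one_mul] at this
  rw [le_div_iff₀ (I.α_pos i)]
  linarith [hD.φ_nonneg i false 1 h1]

theorem DualFeasible.dualObjective_eq {D : DualPoint n} (hD : I.DualFeasible M T D) :
    dualObjective M D = 2 * ∑ i, D.h i := by
  rw [dualObjective, hD.balance]; ring

/-- The variables `λ`, `h`, `p`, `φ` of the dual as a vector space. -/
abbrev DualSpace (n : ℕ) := ℝ × (Fin n → ℝ) × (Fin n → ℝ) × (Fin n → Bool → ℕ → ℝ)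

/-- The constraints of the dual: the signs of `λ`, `h` and `φ`, the play constraints, the probe
constraints, and the two inequalities of the balance constraint. -/
abbrev DualIndex (n : ℕ) :=
  Unit ⊕ Fin n ⊕ (Fin n × Bool × ℕ) ⊕ (Fin n × Bool × ℕ) ⊕ (Fin n × Bool × ℕ) ⊕ Bool

/-- A lower bound of the dual objective is reached by a feasible point of the primal. -/
theorem exists_primal_ge (hM : 1 ≤ M) {d : ℝ}
    (hd : ∀ D, I.DualFeasible M T D → d ≤ dualObjective M D) :
    ∃ P, I.PrimalFeasible M T P ∧ d ≤ I.primalObjective T P := by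
  classical
  obtain ⟨D₀, hD₀⟩ := exists_dualFeasible I hM T
  let L : DualSpace n →ₗ[ℝ] ℝ := LinearMap.fst _ _ _
  let H : Fin n → DualSpace n →ₗ[ℝ] ℝ := fun i =>
    LinearMap.proj i ∘ₗ LinearMap.fst _ _ _ ∘ₗ LinearMap.snd _ _ _
  let Q : Fin n → DualSpace n →ₗ[ℝ] ℝ := fun i =>
    LinearMap.proj i ∘ₗ LinearMap.fst _ _ _ ∘ₗ LinearMap.snd _ _ _ ∘ₗ LinearMap.snd _ _ _
  let Φ : Fin n × Bool × ℕ → DualSpace n →ₗ[ℝ] ℝ := fun k =>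
    (LinearMap.proj k.2.2 : (ℕ → ℝ) →ₗ[ℝ] ℝ) ∘ₗ
    (LinearMap.proj k.2.1 : (Bool → ℕ → ℝ) →ₗ[ℝ] ℕ → ℝ) ∘ₗ
    (LinearMap.proj k.1 : (Fin n → Bool → ℕ → ℝ) →ₗ[ℝ] Bool → ℕ → ℝ) ∘ₗ
    LinearMap.snd _ _ _ ∘ₗ LinearMap.snd _ _ _ ∘ₗ LinearMap.snd _ _ _
  let E : Finset (Fin n × Bool × ℕ) := univ ×ˢ univ ×ˢ Icc 1 T
  let s : Finset (DualIndex n) := univ.disjSum (univ.disjSum (E.disjSum (E.disjSum (E.disjSum univ))))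
  let a : DualIndex n → DualSpace n →ₗ[ℝ] ℝ := Sum.elim (fun _ => L) <| Sum.elim H <| Sum.elim Φ <|
    Sum.elim (fun k => L + Φ k) <| Sum.elim (fun k => (k.2.2 : ℝ) • H k.1 -
      I.gain k.1 k.2.1 k.2.2 • Q k.1 - ∑ l ∈ Icc 1 k.2.2, Φ (k.1, k.2.1, l)) <|
    fun g => if g then (M : ℝ) • L - ∑ i, H i else -((M : ℝ) • L - ∑ i, H i)
  let b : DualIndex n → ℝ := Sum.elim (fun _ => 0) <| Sum.elim (fun _ => 0) <| Sum.elim (fun _ => 0) <|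
    Sum.elim (fun k => I.R k.1 k.2.1 k.2.2) <| Sum.elim (fun k => - I.c k.1) fun _ => 0
  have hL : ∀ y, L y = y.1 := fun _ => rfl
  have hH : ∀ i y, H i y = y.2.1 i := fun _ _ => rfl
  have hQ : ∀ i y, Q i y = y.2.2.1 i := fun _ _ => rfl
  have hΦ : ∀ k y, Φ k y = y.2.2.2 k.1 k.2.1 k.2.2 := fun _ _ => rfl
  have hfeas : ∀ y : DualSpace n, (∀ j ∈ s, b j ≤ a j y) ↔
      0 ≤ y.1 ∧ (∀ i, 0 ≤ y.2.1 i) ∧ (∀ i s, ∀ t ∈ Icc 1 T, 0 ≤ y.2.2.2 i s t) ∧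
      (∀ i s, ∀ t ∈ Icc 1 T, I.R i s t ≤ y.1 + y.2.2.2 i s t) ∧
      (∀ i s, ∀ t ∈ Icc 1 T, I.ProbeConstraint ⟨y.1, y.2.1, y.2.2.1, y.2.2.2⟩ i s t) ∧
      M * y.1 = ∑ i, y.2.1 i := by
    intro y
    have h1 : ∀ i s t, -I.c i ≤ t * y.2.1 i - I.gain i s t * y.2.2.1 i -
        ∑ l ∈ Icc 1 t, y.2.2.2 i s l ↔
        I.ProbeConstraint ⟨y.1, y.2.1, y.2.2.1, y.2.2.2⟩ i s t := by
      intro i s t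
      simp only [ProbeConstraint]
      constructor <;> intro h <;> linarith
    simp only [s, E, Sum.forall, inl_mem_disjSum, inr_mem_disjSum, a, b, Sum.elim_inl,
      Sum.elim_inr, mem_univ, mem_product, true_and, Prod.forall, hL, hH, hΦ, hQ,
      LinearMap.add_apply, LinearMap.sub_apply, LinearMap.smul_apply, LinearMap.sum_apply,
      smul_eq_mul, h1, forall_const, Bool.forall_bool, if_true, Bool.false_eq_true, if_false,
      LinearMap.neg_apply]
    have h2 : (0 ≤ -(M * y.1 - ∑ i, y.2.1 i) ∧ 0 ≤ M * y.1 - ∑ i, y.2.1 i) ↔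
        M * y.1 = ∑ i, y.2.1 i :=
      ⟨fun h => by linarith [h.1, h.2], fun h => by constructor <;> linarith⟩
    rw [h2]
  -- The bound `d` is a consequence of the dual constraints, so it is a nonnegative combination of
  -- them. The weights of the play and probe constraints become `x` and `z`, and the difference of
  -- the two balance weights becomes `ω`.
  obtain ⟨w, hw, hf, hdw⟩ := affine_farkas s a b ((M : ℝ) • L + ∑ i, H i) d
    (D₀.lam, D₀.h, D₀.p, D₀.φ)
    ((hfeas _).2 ⟨hD₀.lam_nonneg, hD₀.h_nonneg, hD₀.φ_nonneg, hD₀.play,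
      fun i s t ht => hD₀.probe i s ht, hD₀.balance⟩)
    (by
      intro y hy
      obtain ⟨h1, h2, h3, h4, h5, h6⟩ := (hfeas y).1 hy
      have := hd _ (dualFeasible_of_free h1 h2 h3 h4 h5 h6)
      simpa [dualObjective, hL, hH] using this)
  let wx : Fin n → Bool → ℕ → ℝ := fun i s t => w (.inr (.inr (.inr (.inl (i, s, t)))))
  let wz : Fin n → Bool → ℕ → ℝ := fun i s t => w (.inr (.inr (.inr (.inr (.inl (i, s, t))))))
  let ω : ℝ := w (.inr (.inr (.inr (.inr (.inr true))))) -
    w (.inr (.inr (.inr (.inr (.inr false)))))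
  have hf' : ∀ y : DualSpace n, M * y.1 + ∑ i, y.2.1 i = w (.inl ()) * y.1 +
      ∑ i, w (.inr (.inl i)) * y.2.1 i +
      (∑ i, ∑ s, ∑ t ∈ Icc 1 T, w (.inr (.inr (.inl (i, s, t)))) * y.2.2.2 i s t) +
      (∑ i, ∑ s, ∑ t ∈ Icc 1 T, wx i s t * (y.1 + y.2.2.2 i s t)) +
      (∑ i, ∑ s, ∑ t ∈ Icc 1 T, wz i s t * (t * y.2.1 i - I.gain i s t * y.2.2.1 i -
        ∑ l ∈ Icc 1 t, y.2.2.2 i s l)) + ω * (M * y.1 - ∑ i, y.2.1 i) := by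
    intro y
    have := hf y
    simp only [s, E, a, sum_disjSum, sum_product, Sum.elim_inl, Sum.elim_inr, LinearMap.add_apply,
      LinearMap.sub_apply, LinearMap.smul_apply, LinearMap.sum_apply, smul_eq_mul, hL, hH, hQ, hΦ,
      Fintype.sum_bool (f := fun g => w (.inr (.inr (.inr (.inr (.inr g))))) * _),
      univ_unique, sum_singleton] at this
    have e : w (.inl default) = w (.inl ()) := rfl
    rw [this, e]
    simp only [if_true, Bool.false_eq_true, if_false, LinearMap.neg_apply, LinearMap.sub_apply,
      LinearMap.smul_apply, LinearMap.sum_apply, smul_eq_mul, hL, hH, ω, wx, wz]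
    ring
  have hdw' : d ≤ ∑ i, ∑ s, ∑ t ∈ Icc 1 T, (wx i s t * I.R i s t - I.c i * wz i s t) := by
    simp only [s, E, b, sum_disjSum, sum_product, Sum.elim_inl, Sum.elim_inr, mul_zero,
      sum_const_zero, zero_add, add_zero, mul_neg, sum_neg_distrib] at hdw
    simp only [sum_sub_distrib]
    simp only [wx, wz, mul_comm (I.c _)]
    linarith
  -- Testing `hf'` on unit vectors for λ, `h`, `φ`, `p` gives the primal constraints in turn. The
  -- weights of the sign constraints are the slacks; `p` has none here, so its coefficient gives an
  -- equality.
  refine ⟨⟨wx, wz, ω⟩, ⟨fun i s t _ => hw _, fun i s t _ => hw _, ?_, ?_, ?_, ?_⟩, ?_⟩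
  · have := hf' (1, 0, 0, 0)
    simp at this
    have h0 := hw (.inl ())
    simp only [sum_add_distrib] at this ⊢
    linarith
  · intro i
    have := hf' (0, Pi.single i 1, 0, 0)
    simp [Pi.single_apply] at this
    have h0 := hw (.inr (.inl i))
    simp only [mul_add, sum_add_distrib] at this ⊢
    simp only [mul_comm (wz _ _ _)] at this
    linarith
  · intro i s t ht
    have hA : ∀ f : Fin n → Bool → ℕ → ℝ, ∑ i', ∑ s', ∑ t' ∈ Icc 1 T,
        f i' s' t' * (if i' = i ∧ s' = s ∧ t' = t then 1 else 0) = f i s t := by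
      intro f
      rw [sum_eq_single i (by intro i' _ h; simp [h]) (by simp),
        sum_eq_single s (by intro i' _ h; simp [h]) (by simp),
        sum_eq_single t (by intro i' _ h; simp [h]) (fun h => (h ht).elim)]
      simp
    have := hf' (0, 0, 0, fun i' s' t' => if i' = i ∧ s' = s ∧ t' = t then 1 else 0)
    simp only [Pi.zero_apply, sum_const_zero, mul_zero, zero_add, hA, sub_zero, zero_sub,
      mul_neg, sum_neg_distrib, sum_mul_sum_Icc, add_zero] at this
    simp only [mul_comm (ite _ _ _), hA] at this
    have h0 := hw (.inr (.inr (.inl (i, s, t))))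
    show wx i s t ≤ ∑ l ∈ Icc t T, wz i s l
    linarith
  · intro i
    have := hf' (0, 0, Pi.single i 1, 0)
    simp [Pi.single_apply] at this
    simp only [gain, if_true, Bool.false_eq_true, if_false, mul_comm (wz _ _ _), neg_mul,
      sum_neg_distrib] at this
    show ∑ t ∈ Icc 1 T, (1 - I.u i t) * wz i true t = ∑ t ∈ Icc 1 T, I.v i t * wz i false t
    linarith
  · rw [primalObjective_eq]
    exact hdw'

/-- The dual attains its minimum. -/
theorem exists_dualOptimal (I : ProbeBandit n) (hM : 1 ≤ M) (hT : 1 ≤ T) :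
    ∃ D, I.DualOptimal M T D := by
  obtain ⟨D₀, hD₀⟩ := exists_dualFeasible I hM T
  let pt : ℝ × (Fin n → ℝ) × (Fin n → ℝ) → DualPoint n := fun y =>
    ⟨y.1, y.2.1, y.2.2, fun i s t => max 0 (I.R i s t - y.1)⟩
  let m := dualObjective M D₀
  -- Points no worse than `D₀` lie in this box: balance and the objective bound λ and `h`, and
  -- `p_le` bounds `p`. With `φ` eliminated, compactness applies.
  let B : Set (ℝ × (Fin n → ℝ) × (Fin n → ℝ)) :=
    Set.Icc 0 (m, fun _ => m, fun i => (m + I.c i) / I.α i)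
  let K := B ∩ {y | I.DualFeasible M T (pt y)}
  have hclosed : IsClosed {y | I.DualFeasible M T (pt y)} := by
    have : {y | I.DualFeasible M T (pt y)} = {y | 0 ≤ y.1 ∧ (∀ i, 0 ≤ y.2.1 i) ∧
        (∀ i, 0 ≤ y.2.2 i) ∧
        (∀ i, ∀ t ∈ Icc 1 T, -I.c i - (1 - I.u i t) * y.2.2 i +
          ∑ l ∈ Icc 1 t, max 0 (I.R i true l - y.1) ≤ t * y.2.1 i) ∧
        (∀ i, ∀ t ∈ Icc 1 T, -I.c i + I.v i t * y.2.2 i +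
          ∑ l ∈ Icc 1 t, max 0 (I.R i false l - y.1) ≤ t * y.2.1 i) ∧
        (M : ℝ) * y.1 = ∑ i, y.2.1 i} := by
      ext y
      constructor
      · rintro ⟨h1, h2, h3, -, -, h4, h5, h6⟩
        exact ⟨h1, h2, h3, h4, h5, h6⟩
      · rintro ⟨h1, h2, h3, h4, h5, h6⟩
        refine ⟨h1, h2, h3, fun i s t _ => le_max_left _ _, fun i s t _ => ?_, h4, h5, h6⟩
        have := le_max_right 0 (I.R i s t - y.1)
        show I.R i s t ≤ y.1 + max 0 (I.R i s t - y.1)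
        linarith
    rw [this]
    simp only [Set.ofPred_and, Set.ofPred_forall]
    refine (isClosed_le (by fun_prop) (by fun_prop)).inter <|
      (isClosed_iInter fun i => isClosed_le (by fun_prop) (by fun_prop)).inter <|
      (isClosed_iInter fun i => isClosed_le (by fun_prop) (by fun_prop)).inter <|
      (isClosed_iInter fun i => isClosed_iInter fun t => isClosed_iInter fun _ =>
        isClosed_le (by fun_prop) (by fun_prop)).inter <|
      (isClosed_iInter fun i => isClosed_iInter fun t => isClosed_iInter fun _ =>
        isClosed_le (by fun_prop) (by fun_prop)).inter <|
      isClosed_eq (by fun_prop) (by fun_prop)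
  have hK : IsCompact K := isCompact_Icc.inter_right hclosed
  have hmem : ∀ D, I.DualFeasible M T D → dualObjective M D ≤ m → (D.lam, D.h, D.p) ∈ K := by
    intro D hD hm
    have hM' : (1 : ℝ) ≤ M := by exact_mod_cast hM
    have hlam := hD.lam_nonneg
    have hh := hD.h_nonneg
    have hs : 0 ≤ ∑ i, D.h i := sum_nonneg fun i _ => hh i
    have e := hD.balance
    have hle : ∀ i, D.h i ≤ m := fun i => by
      have := single_le_sum (fun j _ => hh j) (mem_univ i)
      unfold dualObjective at hm
      linarith
    refine ⟨⟨⟨hlam, hh, hD.p_nonneg⟩, ?_, hle, fun i => (hD.p_le hT i).trans ?_⟩, hD.reduced⟩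
    · unfold dualObjective at hm
      show D.lam ≤ m
      nlinarith
    · exact div_le_div_of_nonneg_right (by linarith [hle i]) (I.α_pos i).le
  obtain ⟨y, hy, hmin⟩ := hK.exists_isMinOn ⟨_, hmem D₀ hD₀ le_rfl⟩
    (f := fun y => dualObjective M (pt y)) (by
      show ContinuousOn (fun y => (M : ℝ) * y.1 + ∑ i, y.2.1 i) K
      fun_prop)
  refine ⟨pt y, hy.2, fun D hD => ?_⟩
  rcases le_total (dualObjective M D) m with h | h
  · exact hmin (hmem D hD h)
  · exact (hmin (hmem D₀ hD₀ le_rfl)).trans h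

theorem exists_primalOptimal (hM : 1 ≤ M) {D : DualPoint n} (hD : I.DualOptimal M T D) :
    ∃ P, I.PrimalOptimal M T P := by
  obtain ⟨P, hP, h⟩ := exists_primal_ge hM hD.2
  exact ⟨P, hP, fun P' hP' => (weak_duality hP' hD.1).trans h⟩

/-- Optimal solutions have equal values. -/
theorem strong_duality (hM : 1 ≤ M) {P : PrimalPoint n} {D : DualPoint n}
    (hP : I.PrimalOptimal M T P) (hD : I.DualOptimal M T D) :
    I.primalObjective T P = dualObjective M D := by
  obtain ⟨P', hP', h⟩ := exists_primal_ge hM hD.2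
  exact le_antisymm (weak_duality hP.1 hD.1) (h.trans (hP.2 P' hP'))

end ProbeBandit

/-! ### Tight probes at the ends of the stages -/

/-- What the analysis of the two-stage policy uses about an arm `i` with the parameters `d`, `e`,
`m`: the probes that end the two stages are tight at the prices `lam`, `h` and `p`. -/
structure ProbeBandit.TightStages {n : ℕ} (I : ProbeBandit n) (lam h p : ℝ) (i : Fin n)
    (d e m : ℕ) : Prop where
  one_le_d : 1 ≤ d
  one_le_e : 1 ≤ e
  m_le_d : m ≤ d
  h_nonneg : 0 ≤ h
  p_nonneg : 0 ≤ p
  good : -I.c i + I.u i e * p + ∑ l ∈ range e, (I.R i true (l + 1) - lam) = p + e * h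
  bad : -I.c i + I.v i d * p + ∑ l ∈ range m, (I.R i false (d - m + l + 1) - lam) = d * h

namespace ProbeBandit
variable {n : ℕ} {I : ProbeBandit n} {M T : ℕ}

/-- Slackness gives Σ t z = 1 + ω for an arm with `h > 0`. This is positive, so the arm is probed at
all, and flow conservation with positive coefficients then forces probes after both observations. -/
theorem exists_probe_pos (hM : 1 ≤ M) {P : PrimalPoint n} {D : DualPoint n}
    (hP : I.PrimalOptimal M T P) (hD : I.DualOptimal M T D) {i : Fin n} (hi : 0 < D.h i) :
    (∃ t ∈ Icc 1 T, 0 < P.z i true t) ∧ ∃ t ∈ Icc 1 T, 0 < P.z i false t := by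
  have hval := strong_duality hM hP hD
  have hs := slack_of_eq hP.1 hD.1 hval
  have hz := hP.1.z_nonneg
  -- Otherwise all `z`, hence all `x`, vanish and the common optimal value is 0, although it equals
  -- 2 Σ h > 0.
  have hω : 0 < 1 + P.ω := by
    by_contra hneg
    push Not at hneg
    have hz0 : ∀ j s, ∀ t ∈ Icc 1 T, P.z j s t = 0 := by
      intro j s t ht
      have h1 : ∀ t ∈ Icc 1 T, 0 ≤ t * (P.z j true t + P.z j false t) := fun t ht =>
        mul_nonneg (Nat.cast_nonneg t) (add_nonneg (hz j true t ht) (hz j false t ht))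
      have h2 := (sum_eq_zero_iff_of_nonneg h1).1
        (le_antisymm ((hP.1.time j).trans hneg) (sum_nonneg h1)) t ht
      have h3 : (0 : ℝ) < t := by exact_mod_cast (mem_Icc.1 ht).1
      have h4 := (mul_eq_zero.1 h2).resolve_left h3.ne'
      have h5 := hz j true t ht
      have h6 := hz j false t ht
      cases s <;> linarith
    have hx0 : ∀ j s, ∀ t ∈ Icc 1 T, P.x j s t = 0 := by
      intro j s t ht
      refine le_antisymm ((hP.1.play_le j s t ht).trans (sum_nonpos fun l hl => ?_))
        (hP.1.x_nonneg j s t ht)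
      refine (hz0 j s l ?_).le
      simp only [mem_Icc] at hl ht ⊢
      omega
    have h0 : I.primalObjective T P = 0 := by
      rw [primalObjective_eq]
      refine sum_eq_zero fun j _ => sum_eq_zero fun s _ => sum_eq_zero fun t ht => ?_
      rw [hx0 j s t ht, hz0 j s t ht]
      simp
    have h1 := single_le_sum (fun j _ => hD.1.h_nonneg j) (mem_univ i)
    rw [hD.1.dualObjective_eq] at hval
    linarith
  have hg : ∀ t ∈ Icc 1 T, 0 < 1 - I.u i t := fun t ht =>
    sub_pos.2 (I.u_lt_one i (mem_Icc.1 ht).1)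
  have hb : ∀ t ∈ Icc 1 T, 0 < I.v i t := fun t ht => I.v_pos i (mem_Icc.1 ht).1
  have hflow := hP.1.flow i
  have htime := hs.time i hi.ne'
  rw [Fintype.sum_bool] at htime
  have zero_of : ∀ (f : ℕ → ℝ), (∀ t ∈ Icc 1 T, 0 < f t) → ∀ s,
      ∑ t ∈ Icc 1 T, f t * P.z i s t = 0 → ∀ t ∈ Icc 1 T, P.z i s t = 0 := by
    intro f hf s h0 t ht
    have := (sum_eq_zero_iff_of_nonneg fun t ht =>
      mul_nonneg (hf t ht).le (hz i s t ht)).1 h0 t ht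
    exact (mul_eq_zero.1 this).resolve_left (hf t ht).ne'
  by_contra hcon
  have hall : (∀ t ∈ Icc 1 T, P.z i true t = 0) ∧ ∀ t ∈ Icc 1 T, P.z i false t = 0 := by
    rw [not_and_or] at hcon
    rcases hcon with h | h <;> push Not at h
    · have h0 : ∀ t ∈ Icc 1 T, P.z i true t = 0 := fun t ht =>
        le_antisymm (h t ht) (hz i true t ht)
      refine ⟨h0, zero_of _ hb false ?_⟩
      rw [← hflow]
      exact sum_eq_zero fun t ht => by rw [h0 t ht, mul_zero]
    · have h0 : ∀ t ∈ Icc 1 T, P.z i false t = 0 := fun t ht =>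
        le_antisymm (h t ht) (hz i false t ht)
      refine ⟨zero_of _ hg true ?_, h0⟩
      rw [hflow]
      exact sum_eq_zero fun t ht => by rw [h0 t ht, mul_zero]
  rw [sum_eq_zero fun t ht => by rw [hall.1 t ht, mul_zero],
    sum_eq_zero fun t ht => by rw [hall.2 t ht, mul_zero]] at htime
  linarith

/-- A positive `z` at `d` and `e` makes those probe constraints tight. What remains is to identify
the `φ` in them with R − λ over exactly the steps that the policy plays. -/
theorem tightStages (hM : 1 ≤ M) {P : PrimalPoint n} {D : DualPoint n}
    (hP : I.PrimalOptimal M T P) (hD : I.DualOptimal M T D) {i : Fin n} (hi : 0 < D.h i) :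
    I.TightStages D.lam (D.h i) (D.p i) i ((stageParams T P D).d i) ((stageParams T P D).e i)
      ((stageParams T P D).m i) := by
  have hs := slack_of_eq hP.1 hD.1 (strong_duality hM hP hD)
  have hz := hP.1.z_nonneg
  obtain ⟨hE, hB⟩ := exists_probe_pos hM hP hD hi
  have he := Nat.sInf_mem (s := {t | t ∈ Icc 1 T ∧ 0 < P.z i true t}) hE
  have hd := Nat.sInf_mem (s := {t | t ∈ Icc 1 T ∧ 0 < P.z i false t}) hB
  have hm : (stageParams T P D).m i = #{l ∈ Icc 1 ((stageParams T P D).d i) | 0 < D.φ i false l} :=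
    rfl
  change (stageParams T P D).e i ∈ _ at he
  change (stageParams T P D).d i ∈ _ at hd
  generalize (stageParams T P D).e i = e at *
  generalize (stageParams T P D).d i = d at *
  generalize (stageParams T P D).m i = m at *
  obtain ⟨heT, hze⟩ := he
  obtain ⟨hdT, hzd⟩ := hd
  have he1 := mem_Icc.1 heT
  have hd1 := mem_Icc.1 hdT
  -- A positive `φ` at `l` forces `x` at `l` to equal the tail sum of `z`, which contains the
  -- positive entry at `k`; so `x` is positive and the play constraint is tight.
  have tight : ∀ s k, k ∈ Icc 1 T → 0 < P.z i s k → ∀ l ∈ Icc 1 k, 0 < D.φ i s l →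
      D.lam + D.φ i s l = I.R i s l := by
    intro s k hk hzk l hl hφ
    have hlT : l ∈ Icc 1 T := by simp only [mem_Icc] at *; omega
    refine hs.play i s l hlT ?_
    rw [hs.play_le i s l hlT hφ.ne']
    have h1 : ∀ j ∈ Icc l T, 0 ≤ P.z i s j := fun j hj => hz i s j (by
      simp only [mem_Icc] at *; omega)
    exact (hzk.trans_le (single_le_sum h1 (by simp only [mem_Icc] at *; omega))).ne'
  have tg := hs.probe i true e heT hze.ne'
  have tb := hs.probe i false d hdT hzd.ne'
  simp only [gain, if_true, Bool.false_eq_true, if_false] at tg tb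
  have hφT : ∀ s, ∀ l, 1 ≤ l → l ≤ T → 0 ≤ D.φ i s l := fun s l h1 h2 =>
    hD.1.φ_nonneg i s l (mem_Icc.2 ⟨h1, h2⟩)
  have hplay : ∀ s, ∀ l, 1 ≤ l → l ≤ T → I.R i s l ≤ D.lam + D.φ i s l := fun s l h1 h2 =>
    hD.1.play i s l (mem_Icc.2 ⟨h1, h2⟩)
  have hmd : m ≤ d := by
    rw [hm]
    exact (card_filter_le _ _).trans (by simp)
  refine ⟨hd1.1, he1.1, hmd, hi.le, hD.1.p_nonneg i, ?_, ?_⟩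
  -- If this `φ` were 0, the tight constraint at `e` would contradict the one at `e - 1` (or the
  -- bound 0 if `e = 1`): its left side would not be larger, while the right side grows by `h > 0`.
  · have hφe : 0 < D.φ i true e := by
      by_contra hneg
      have h0 : D.φ i true e = 0 := le_antisymm (not_lt.1 hneg) (hφT _ _ he1.1 he1.2)
      rcases he1.1.eq_or_lt with h1 | h1
      · subst h1
        simp only [Icc_self, sum_singleton, h0] at tg
        have := mul_nonneg (sub_nonneg.2 (I.u_le_one i 1)) (hD.1.p_nonneg i)
        have := I.c_nonneg i
        norm_num at tg
        linarith
      · obtain ⟨k, rfl⟩ : ∃ k, e = k + 1 := ⟨e - 1, by omega⟩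
        have hk : k ∈ Icc 1 T := mem_Icc.2 ⟨by omega, by omega⟩
        have := hD.1.good i k hk
        rw [sum_Icc_succ_top (by omega), h0] at tg
        have := mul_le_mul_of_nonneg_right (I.u_anti i (Nat.le_succ k)) (hD.1.p_nonneg i)
        simp only [Nat.succ_eq_add_one] at this
        push_cast at tg
        linarith
    -- At `e` the reward exceeds λ. Earlier rewards after a good observation are at least as large,
    -- so all these `φ` are positive and tight.
    have hφl : ∀ l ∈ Icc 1 e, D.φ i true l = I.R i true l - D.lam := by
      intro l hl
      have h1 := tight true e heT hze e (by simp [he1.1]) hφe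
      have hl' := mem_Icc.1 hl
      have h2 := I.R_true_anti i hl'.2
      have h3 := hplay true l hl'.1 (by omega)
      have h4 := tight true e heT hze l hl (by linarith)
      linarith
    rw [sum_congr rfl hφl] at tg
    rw [range_eq_Ico, sum_Ico_add' (fun l => I.R i true l - D.lam) 0 e 1]
    have : Ico (0 + 1) (e + 1) = Icc 1 e := by ext; simp
    rw [this]
    linarith
  · have hup : ∀ l l', 1 ≤ l → l ≤ l' → l' ≤ d → 0 < D.φ i false l → 0 < D.φ i false l' := by
      intro l l' h1 h2 h3 h4
      have h5 := tight false d hdT hzd l (mem_Icc.2 ⟨h1, h2.trans h3⟩) h4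
      have h6 := I.R_false_mono i h2
      have h7 := hplay false l' (by omega) (by omega)
      linarith
    -- After a bad observation rewards increase, so the times with positive `φ` are closed upwards
    -- in [1, d]; having `m` elements, they are the last `m` times.
    have hF : ({l ∈ Icc 1 d | 0 < D.φ i false l} : Finset ℕ) = Ico (d - m + 1) (d + 1) := by
      refine eq_of_subset_of_card_le (fun l hl => ?_) ?_
      · rw [mem_filter, mem_Icc] at hl
        have hsub : Icc l d ⊆ ({l ∈ Icc 1 d | 0 < D.φ i false l} : Finset ℕ) := by
          intro l' hl'
          rw [mem_Icc] at hl'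
          rw [mem_filter, mem_Icc]
          exact ⟨⟨by omega, hl'.2⟩, hup l l' hl.1.1 hl'.1 hl'.2 hl.2⟩
        have := card_le_card hsub
        rw [← hm, Nat.card_Icc] at this
        rw [mem_Ico]
        omega
      · rw [← hm, Nat.card_Ico]
        omega
    have hsum : ∑ l ∈ Icc 1 d, D.φ i false l =
        ∑ l ∈ Ico (d - m + 1) (d + 1), (I.R i false l - D.lam) := by
      rw [← hF, ← sum_filter_of_ne (p := fun l => 0 < D.φ i false l)]
      · refine sum_congr rfl fun l hl => ?_
        rw [mem_filter] at hl
        have := tight false d hdT hzd l hl.1 hl.2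
        linarith
      · intro l hl hne
        have hl' := mem_Icc.1 hl
        exact lt_of_le_of_ne (hφT _ _ hl'.1 (by omega)) hne.symm
    rw [hsum] at tb
    have e1 : ∑ l ∈ range m, (I.R i false (d - m + l + 1) - D.lam) =
        ∑ l ∈ Ico (d - m + 1) (d + 1), (I.R i false l - D.lam) := by
      rw [sum_Ico_eq_sum_range]
      have : d + 1 - (d - m + 1) = m := by omega
      rw [this]
      refine sum_congr rfl fun l _ => ?_
      congr 2
      omega
    rw [e1]
    exact tb

end ProbeBandit

/-! ### Beliefs, expected values and the potential function method -/

/-- The last observed state of an arm. -/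
def lastObs {n : ℕ} (s₀ : Fin n → Bool) : History n → Fin n → Bool
  | [], i => s₀ i
  | .played _ :: h, i => lastObs s₀ h i
  | .probed a good :: h, i => if i = a then good else lastObs s₀ h i

/-- The number of time steps since the last observation of an arm. -/
def age {n : ℕ} : History n → Fin n → ℕ
  | [], _ => 0
  | .played _ :: h, i => age h i + 1
  | .probed a _ :: h, i => if i = a then 0 else age h i

theorem PMF.sum_toReal_mul_le {A : Type*} [Fintype A] (p : PMF A) {f : A → ℝ} {y : ℝ}
    (h : ∀ a ∈ p.support, f a ≤ y) : ∑ a, (p a).toReal * f a ≤ y := by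
  have h1 : ∑ a, (p a).toReal = 1 := by
    have := p.tsum_coe
    rw [tsum_fintype] at this
    rw [← ENNReal.toReal_sum fun a _ => p.apply_ne_top a, this, ENNReal.toReal_one]
  calc ∑ a, (p a).toReal * f a ≤ ∑ a, (p a).toReal * y := by
        refine sum_le_sum fun a _ => ?_
        by_cases ha : a ∈ p.support
        · exact mul_le_mul_of_nonneg_left (h a ha) ENNReal.toReal_nonneg
        · rw [(p.apply_eq_zero_iff a).2 ha]
          simp
    _ = y := by rw [← sum_mul, h1, one_mul]

namespace ProbeBandit
variable {n : ℕ} (I : ProbeBandit n)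

/-- Probability that arm `i` is in state `s` when it was observed in state `o` exactly `t` steps
ago. -/
def stateProb (i : Fin n) (o : Bool) (t : ℕ) (s : Bool) : ℝ :=
  if s then (if o then I.u i t else I.v i t) else 1 - if o then I.u i t else I.v i t

theorem sum_stateProb (i : Fin n) (o : Bool) (t : ℕ) : ∑ s, I.stateProb i o t s = 1 := by
  simp [stateProb]

theorem stateProb_zero (i : Fin n) (o s : Bool) :
    I.stateProb i o 0 s = if s = o then 1 else 0 := by
  cases o <;> cases s <;> simp [stateProb, u_zero, v_zero]

theorem v_succ (i : Fin n) (t : ℕ) :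
    I.v i (t + 1) = I.v i t * (1 - I.β i) + (1 - I.v i t) * I.α i := by
  have := (I.rate_pos i).ne'
  simp only [v, pow_succ]
  field_simp
  ring

theorem u_succ (i : Fin n) (t : ℕ) :
    I.u i (t + 1) = I.u i t * (1 - I.β i) + (1 - I.u i t) * I.α i := by
  have := (I.rate_pos i).ne'
  simp only [u, pow_succ]
  field_simp
  ring

/-- One-step transition probability of arm `i`. -/
def stepProb (i : Fin n) (s s' : Bool) : ℝ :=
  match s, s' with
  | false, true => I.α i
  | false, false => 1 - I.α i
  | true, false => I.β i
  | true, true => 1 - I.β i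

theorem trans_eq (s s' : Fin n → Bool) : I.trans s s' = ∏ i, I.stepProb i (s i) (s' i) := rfl

theorem stateProb_succ (i : Fin n) (o : Bool) (t : ℕ) (s' : Bool) :
    I.stateProb i o (t + 1) s' = ∑ s, I.stateProb i o t s * I.stepProb i s s' := by
  cases o <;> cases s' <;> simp [stateProb, stepProb, u_succ, v_succ] <;> ring

/-- Probability of the joint hidden state during a time step, given the history. -/
def belief (s₀ : Fin n → Bool) (h : History n) (s : Fin n → Bool) : ℝ :=
  ∏ i, I.stateProb i (lastObs s₀ h i) (age h i) (s i)

/-- Probability of the joint hidden state in the next time step, given the history. -/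
def nextBelief (s₀ : Fin n → Bool) (h : History n) (s : Fin n → Bool) : ℝ :=
  ∏ i, I.stateProb i (lastObs s₀ h i) (age h i + 1) (s i)

variable (s₀ : Fin n → Bool)

theorem belief_played (h : History n) (A : Finset (Fin n)) :
    I.belief s₀ (.played A :: h) = I.nextBelief s₀ h := rfl

theorem sum_belief (h : History n) : ∑ s, I.belief s₀ h s = 1 := by
  unfold belief
  have := prod_univ_sum (fun _ : Fin n => (univ : Finset Bool))
    (fun i b => I.stateProb i (lastObs s₀ h i) (age h i) b)
  rw [Fintype.piFinset_univ] at this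
  rw [← this]
  exact prod_eq_one fun i _ => I.sum_stateProb _ _ _

theorem sum_belief_mul_trans (h : History n) (s' : Fin n → Bool) :
    ∑ s, I.belief s₀ h s * I.trans s s' = I.nextBelief s₀ h s' := by
  unfold belief nextBelief
  simp only [trans_eq, ← prod_mul_distrib]
  have := prod_univ_sum (fun _ : Fin n => (univ : Finset Bool))
    (fun i b => I.stateProb i (lastObs s₀ h i) (age h i) b * I.stepProb i b (s' i))
  rw [Fintype.piFinset_univ] at this
  rw [← this]
  exact prod_congr rfl fun i _ => (I.stateProb_succ _ _ _ _).symm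

theorem belief_probed (h : History n) (i : Fin n) (g : Bool) (s : Fin n → Bool) :
    I.belief s₀ (.probed i g :: h) s =
      (if s i = g then 1 else 0) *
        ∏ j ∈ univ.erase i, I.stateProb j (lastObs s₀ h j) (age h j) (s j) := by
  unfold belief
  rw [← mul_prod_erase univ _ (mem_univ i)]
  simp only [lastObs, age, if_true, stateProb_zero]
  congr 1
  refine prod_congr rfl fun j hj => ?_
  rw [if_neg (ne_of_mem_erase hj), if_neg (ne_of_mem_erase hj)]

/-- Probability of the outcome `g` of a probe of arm `i`. -/
def probeProb (h : History n) (i : Fin n) (g : Bool) : ℝ :=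
  I.stateProb i (lastObs s₀ h i) (age h i) g

/-- Conditioning on the state of arm `i`. -/
theorem sum_belief_mul (h : History n) (i : Fin n) (f : Bool → (Fin n → Bool) → ℝ) :
    ∑ s, I.belief s₀ h s * f (s i) s =
      ∑ g, I.probeProb s₀ h i g * ∑ s, I.belief s₀ (.probed i g :: h) s * f g s := by
  simp only [mul_sum]
  rw [sum_comm]
  refine sum_congr rfl fun s _ => ?_
  simp only [belief_probed, ite_mul, one_mul, zero_mul, mul_ite, mul_zero, sum_ite_eq, mem_univ,
    if_true]
  rw [belief, ← mul_prod_erase univ _ (mem_univ i), probeProb]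
  ring

variable {M : ℕ} (π : Policy n M)

/-- Expected value of the next `k` time steps, given the history. -/
def expValue (k : ℕ) (h : History n) : ℝ :=
  ∑ s, I.nextBelief s₀ h s * I.valueToGo π k h s

/-- Expected value of the rest of the time step, when at most `j` further probes can be made, and
of the `k` time steps that follow, given the history. -/
def expProbeValue (k j : ℕ) (h : History n) : ℝ :=
  ∑ s, I.belief s₀ h s *
    I.probeValue π s (fun h' => ∑ s', I.trans s s' * I.valueToGo π k h' s') j h

theorem averageValue_eq (k : ℕ) : I.averageValue π s₀ k = I.expValue s₀ π k [] / k := by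
  unfold averageValue expValue
  congr 1
  refine sum_congr rfl fun s _ => ?_
  congr 1
  refine prod_congr rfl fun i _ => ?_
  show _ = I.stateProb i (s₀ i) 1 (s i)
  rw [stateProb, u_one, v_one]
  cases s₀ i <;> cases s i <;> simp

theorem sum_belief_mul_cont (k : ℕ) (h : History n) :
    ∑ s, I.belief s₀ h s * ∑ s', I.trans s s' * I.valueToGo π k h s' = I.expValue s₀ π k h := by
  simp only [mul_sum]
  rw [sum_comm]
  refine sum_congr rfl fun s' _ => ?_
  rw [← sum_belief_mul_trans, sum_mul]
  exact sum_congr rfl fun s _ => by ring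

theorem expProbeValue_zero (k : ℕ) (h : History n) :
    I.expProbeValue s₀ π k 0 h = I.expValue s₀ π k h :=
  I.sum_belief_mul_cont s₀ π k h

/-- Conditioning on the outcome of a probe gives the belief of the extended history, so the hidden
state disappears from the recursion. -/
theorem expProbeValue_succ (k j : ℕ) (h : History n) :
    I.expProbeValue s₀ π k (j + 1) h = ∑ o, (π.probe h o).toReal * match o with
      | none => I.expValue s₀ π k h
      | some i => ∑ g, I.probeProb s₀ h i g *
          (-I.c i + I.expProbeValue s₀ π k j (.probed i g :: h)) := by
  unfold expProbeValue
  simp only [probeValue, mul_sum]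
  rw [sum_comm]
  refine sum_congr rfl fun o _ => ?_
  simp only [mul_left_comm (I.belief _ _ _), ← mul_sum]
  congr 1
  cases o with
  | none => exact I.sum_belief_mul_cont s₀ π k h
  | some i =>
    simp only
    rw [I.sum_belief_mul s₀ h i fun g s => -I.c i + I.probeValue π s
      (fun h' => ∑ s', I.trans s s' * I.valueToGo π k h' s') j (.probed i g :: h)]
    simp only [mul_add, sum_add_distrib, ← sum_mul, sum_belief, one_mul]

theorem expValue_succ (k : ℕ) (h : History n) :
    I.expValue s₀ π (k + 1) h = ∑ A, (π.play h A).toReal *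
      ((∑ i ∈ A, I.R i (lastObs s₀ h i) (age h i + 1)) +
        I.expProbeValue s₀ π k n (.played A :: h)) := by
  unfold expValue
  simp only [valueToGo, mul_sum]
  rw [sum_comm]
  refine sum_congr rfl fun A _ => ?_
  simp only [mul_left_comm (I.nextBelief _ _ _), ← mul_sum]
  congr 1
  simp only [mul_add, sum_add_distrib]
  congr 1
  simp only [mul_sum]
  rw [sum_comm]
  refine sum_congr rfl fun i _ => ?_
  have := I.sum_belief_mul s₀ (.played A :: h) i fun g _ => if g then I.r i else 0
  rw [belief_played] at this
  rw [this]
  simp only [← sum_mul, sum_belief, one_mul]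
  simp only [mul_ite, mul_zero, Fintype.sum_bool, if_true, Bool.false_eq_true, if_false, add_zero]
  rw [R, mul_comm]
  cases hs : lastObs s₀ h i <;> simp [probeProb, stateProb, lastObs, age, hs]

/-- The potential function method, for upper bounds (`σ = 1`) and for lower bounds (`σ = -1`) on the
value of a policy. -/
theorem expValue_potential {s₀} {π : Policy n M} (F : History n → ℝ) (σ κ K : ℝ)
    (hplay : ∀ h, Visits π none h → ∀ A ∈ (π.play h).support,
      σ * ((∑ i ∈ A, I.R i (lastObs s₀ h i) (age h i + 1)) + F (.played A :: h)) ≤ σ * (κ + F h))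
    (hprobe : ∀ k h, Visits π (some (k + 1)) h → ∀ i, some i ∈ (π.probe h).support →
      σ * (-I.c i + ∑ g, I.probeProb s₀ h i g * F (.probed i g :: h)) ≤ σ * F h)
    (hend : ∀ h, Visits π none h → -K ≤ σ * F h) (k : ℕ) (h : History n) (hv : Visits π none h) :
    σ * I.expValue s₀ π k h ≤ σ * (k * κ + F h) + K := by
  have nonneg : ∀ h i g, 0 ≤ I.probeProb s₀ h i g := by
    intro h i g
    unfold probeProb stateProb
    have := I.u_le_one i (age h i)
    have := I.v_le_one i (age h i)
    have := I.u_nonneg i (age h i)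
    have := I.v_nonneg i (age h i)
    split_ifs <;> linarith
  induction k generalizing h with
  | zero =>
    have := hend h hv
    simp [expValue, valueToGo]
    linarith
  | succ k ih =>
    have hp : ∀ j h, Visits π (some j) h →
        σ * I.expProbeValue s₀ π k j h ≤ σ * (k * κ + F h) + K := by
      intro j
      induction j with
      | zero =>
        intro h hv
        rw [expProbeValue_zero]
        exact ih h (.last hv)
      | succ j ihj =>
        intro h hv
        rw [expProbeValue_succ, mul_sum]
        simp only [mul_left_comm σ]
        refine PMF.sum_toReal_mul_le _ fun o ho => ?_
        cases o with
        | none => exact ih h (.finish hv ho)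
        | some i =>
          have h1 : ∀ g, I.probeProb s₀ h i g *
              (σ * (-I.c i + I.expProbeValue s₀ π k j (.probed i g :: h))) ≤
              I.probeProb s₀ h i g * (σ * (-I.c i) + (σ * (k * κ + F (.probed i g :: h)) + K)) :=
            fun g => mul_le_mul_of_nonneg_left (by
              rw [mul_add]
              exact add_le_add le_rfl (ihj _ (.probe g hv ho))) (nonneg h i g)
          have h2 := sum_le_sum fun g (_ : g ∈ univ) => h1 g
          have h3 : ∑ g, I.probeProb s₀ h i g = 1 := I.sum_stateProb _ _ _
          have h4 := hprobe j h hv i ho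
          rw [Fintype.sum_bool] at h2 h3 h4
          rw [Fintype.sum_bool] at h2
          simp only
          rw [Fintype.sum_bool, mul_add]
          have h5 : I.probeProb s₀ h i false = 1 - I.probeProb s₀ h i true := by linarith
          rw [h5] at h2 h4 ⊢
          ring_nf at h2 h4 ⊢
          linarith
    rw [expValue_succ, mul_sum]
    simp only [mul_left_comm σ]
    refine PMF.sum_toReal_mul_le _ fun A hA => ?_
    have h1 := hp n _ (.play hv hA)
    have h2 := hplay h hv A hA
    push_cast
    ring_nf at h1 h2 ⊢
    linarith

end ProbeBandit
-- Upper bound on the value of all policies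
namespace ProbeBandit
variable {n : ℕ} {I : ProbeBandit n} {M T : ℕ}

theorem sum_range_add_one (f : ℕ → ℝ) (t : ℕ) :
    ∑ l ∈ range t, f (l + 1) = ∑ l ∈ Icc 1 t, f l := by
  rw [range_eq_Ico, sum_Ico_add' f 0 t 1]
  rfl

/-- Potential of an arm that was observed in state `o` exactly `t` steps ago. -/
def ageValue (I : ProbeBandit n) (lam h p : ℝ) (i : Fin n) (o : Bool) (t : ℕ) : ℝ :=
  (if o then p else 0) + t * h - ∑ l ∈ range t, max 0 (I.R i o (l + 1) - lam)

/-- Dual prices that obey the probe constraints at all times bound the value of all policies. -/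
theorem expValue_le {lam : ℝ} {h p : Fin n → ℝ} (hlam : 0 ≤ lam) (hp : ∀ i, 0 ≤ p i)
    (hcon : ∀ i s t, -I.c i + I.gain i s t * p i +
      ∑ l ∈ range t, max 0 (I.R i s (l + 1) - lam) ≤ t * h i)
    (s₀ : Fin n → Bool) (π : Policy n M) (k : ℕ) :
    I.expValue s₀ π k [] ≤ k * (M * lam + ∑ i, h i) +
      ∑ i, (I.ageValue lam (h i) (p i) i (s₀ i) 0 + I.c i) := by
  -- The probe constraint rearranged: after the probe the potential is `p` or 0, so the left side is
  -- its expectation minus the cost.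
  have hage : ∀ i o t, -I.c i + I.stateProb i o t true * p i ≤
      I.ageValue lam (h i) (p i) i o t := by
    intro i o t
    have := hcon i o t
    unfold ageValue
    cases o
    · simp [gain, stateProb] at this ⊢
      linarith
    · simp [gain, stateProb] at this ⊢
      linarith
  have main := I.expValue_potential (s₀ := s₀) (π := π)
    (fun H => ∑ i, I.ageValue lam (h i) (p i) i (lastObs s₀ H i) (age H i)) 1
    (M * lam + ∑ i, h i) (∑ i, I.c i) ?_ ?_ ?_ k [] .start
  · simp only [one_mul] at main
    rw [sum_add_distrib]
    simp only [lastObs, age] at main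
    linarith
  · intro H _ A hA
    have hcard : (A.card : ℝ) ≤ M := by exact_mod_cast π.card_le H A hA
    have e : ∀ i, I.ageValue lam (h i) (p i) i (lastObs s₀ H i) (age H i + 1) =
        I.ageValue lam (h i) (p i) i (lastObs s₀ H i) (age H i) + h i -
          max 0 (I.R i (lastObs s₀ H i) (age H i + 1) - lam) := by
      intro i
      simp only [ageValue, sum_range_succ]
      push_cast
      ring
    have h1 : ∑ i ∈ A, I.R i (lastObs s₀ H i) (age H i + 1) ≤
        ∑ i ∈ A, (lam + max 0 (I.R i (lastObs s₀ H i) (age H i + 1) - lam)) :=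
      sum_le_sum fun i _ => by linarith [le_max_right 0 (I.R i (lastObs s₀ H i) (age H i + 1) - lam)]
    have h2 : ∑ i ∈ A, max 0 (I.R i (lastObs s₀ H i) (age H i + 1) - lam) ≤
        ∑ i, max 0 (I.R i (lastObs s₀ H i) (age H i + 1) - lam) :=
      sum_le_sum_of_subset_of_nonneg (subset_univ A) fun i _ _ => le_max_left _ _
    rw [sum_add_distrib, sum_const, nsmul_eq_mul] at h1
    have h3 := mul_le_mul_of_nonneg_right hcard hlam
    simp only [lastObs, age, e, sum_sub_distrib, sum_add_distrib]
    linarith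
  · intro _ H _ i _
    rw [Fintype.sum_bool, ← add_sum_erase univ _ (mem_univ i), ← add_sum_erase univ _ (mem_univ i),
      ← add_sum_erase univ _ (mem_univ i)]
    have e : ∀ g, ∑ j ∈ univ.erase i, I.ageValue lam (h j) (p j) j
        (lastObs s₀ (.probed i g :: H) j) (age (.probed i g :: H) j) =
        ∑ j ∈ univ.erase i, I.ageValue lam (h j) (p j) j (lastObs s₀ H j) (age H j) := by
      intro g
      refine sum_congr rfl fun j hj => ?_
      simp only [lastObs, age, if_neg (ne_of_mem_erase hj)]
    rw [e, e]
    have h1 := hage i (lastObs s₀ H i) (age H i)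
    have h2 : ∑ g, I.probeProb s₀ H i g = 1 := I.sum_stateProb _ _ _
    rw [Fintype.sum_bool] at h2
    change _ + I.probeProb s₀ H i true * _ ≤ _ at h1
    have h3 : ∀ g, I.ageValue lam (h i) (p i) i (lastObs s₀ (.probed i g :: H) i)
        (age (.probed i g :: H) i) = if g then p i else 0 := by
      intro g
      simp [ageValue, lastObs, age]
    rw [h3, h3]
    simp only [if_true, Bool.false_eq_true, if_false]
    have h4 : I.probeProb s₀ H i false = 1 - I.probeProb s₀ H i true := by linarith
    rw [h4]
    linarith
  · intro H _
    rw [one_mul, ← sum_neg_distrib]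
    refine sum_le_sum fun i _ => le_trans ?_ (hage i _ _)
    have h1 : 0 ≤ I.stateProb i (lastObs s₀ H i) (age H i) true := by
      have := I.u_nonneg i (age H i)
      have := I.v_nonneg i (age H i)
      simp only [stateProb, if_true]
      split_ifs <;> assumption
    have := mul_nonneg h1 (hp i)
    linarith

/-- A feasible point with horizon `T` becomes feasible at all times when `h` is increased by
`(c + p) / T`. -/
theorem DualFeasible.extend {D : DualPoint n} (hD : I.DualFeasible M T D) (hT : 1 ≤ T) (i : Fin n)
    (s : Bool) (t : ℕ) : -I.c i + I.gain i s t * D.p i +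
      ∑ l ∈ range t, max 0 (I.R i s (l + 1) - D.lam) ≤ t * (D.h i + (I.c i + D.p i) / T) := by
  have hc := I.c_nonneg i
  have hp := hD.p_nonneg i
  have hT' : (0 : ℝ) < T := by exact_mod_cast hT
  have hx : 0 ≤ (I.c i + D.p i) / T := by positivity
  have hshort : ∀ s t, t ≤ T → -I.c i + I.gain i s t * D.p i +
      ∑ l ∈ range t, max 0 (I.R i s (l + 1) - D.lam) ≤ t * D.h i := by
    intro s t ht
    rcases Nat.eq_zero_or_pos t with rfl | h0
    · cases s <;> simp [gain, u_zero, v_zero, hc]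
    · have := hD.reduced.probe i s (mem_Icc.2 ⟨h0, ht⟩)
      rw [sum_range_add_one (fun l => max 0 (I.R i s l - D.lam))]
      exact this
  rcases le_or_gt t T with ht | ht
  · refine (hshort s t ht).trans ?_
    have : 0 ≤ (t : ℝ) * ((I.c i + D.p i) / T) := by positivity
    linarith
  · have hgood := hshort true T le_rfl
    -- Every excess beyond `T`, in either state, is at most each of the first `T` good excesses. It
    -- is thus at most their average, which the good constraint at `T` bounds.
    have hrate : ∀ l, T ≤ l → max 0 (I.R i s (l + 1) - D.lam) ≤
        D.h i + (I.c i + D.p i) / T := by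
      intro l hl
      have h1 : ∀ j ∈ range T, max 0 (I.R i s (l + 1) - D.lam) ≤
          max 0 (I.R i true (j + 1) - D.lam) := by
        intro j hj
        refine max_le_max le_rfl (sub_le_sub_right ?_ _)
        cases s
        · exact I.R_false_le_true _ _ _
        · exact I.R_true_anti i (by have := mem_range.1 hj; omega)
      have h2 := sum_le_sum h1
      rw [sum_const, card_range, nsmul_eq_mul] at h2
      have h3 := mul_nonneg (I.u_nonneg i T) hp
      simp only [gain, if_true] at hgood
      rw [← mul_le_mul_iff_of_pos_left hT', mul_add, mul_div_cancel₀ _ hT'.ne']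
      linarith
    obtain ⟨k, rfl⟩ : ∃ k, t = T + k := ⟨t - T, by omega⟩
    rw [sum_range_add]
    have h1 : ∑ j ∈ range k, max 0 (I.R i s (T + j + 1) - D.lam) ≤
        k * (D.h i + (I.c i + D.p i) / T) := by
      refine (sum_le_sum fun j _ => hrate (T + j) (Nat.le_add_right _ _)).trans ?_
      rw [sum_const, card_range, nsmul_eq_mul]
    have h2 := hshort s T le_rfl
    -- The coefficient of `p` grows by at most 1 after `T`; the increase of `h` has accumulated `c +
    -- p` by then.
    have h3 : I.gain i s (T + k) * D.p i ≤ I.gain i s T * D.p i + D.p i := by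
      have h4 : I.gain i s (T + k) ≤ I.gain i s T + 1 := by
        cases s
        · simp only [gain, Bool.false_eq_true, if_false]
          linarith [I.v_le_one i (T + k), I.v_nonneg i T]
        · simp only [gain, if_true]
          linarith [I.u_le_one i (T + k), I.u_nonneg i T]
      have := mul_le_mul_of_nonneg_right h4 hp
      linarith
    have h5 : (T : ℝ) * (D.h i + (I.c i + D.p i) / T) = T * D.h i + (I.c i + D.p i) := by
      rw [mul_add, mul_div_cancel₀ _ hT'.ne']
    push_cast
    rw [add_mul, h5]
    linarith

/-- The bound on the long-run value of all policies that a feasible point of the dual gives. -/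
def extendedValue (I : ProbeBandit n) (M T : ℕ) (D : DualPoint n) : ℝ :=
  M * D.lam + ∑ i, (D.h i + (I.c i + D.p i) / T)

theorem DualFeasible.averageValue_le {D : DualPoint n} (hD : I.DualFeasible M T D) (hT : 1 ≤ T)
    (π : Policy n M) (s₀ : Fin n → Bool) :
    ∃ C, ∀ k : ℕ, 0 < k → I.averageValue π s₀ k ≤ I.extendedValue M T D + C / k := by
  refine ⟨∑ i, (I.ageValue D.lam (D.h i + (I.c i + D.p i) / T) (D.p i) i (s₀ i) 0 + I.c i),
    fun k hk => ?_⟩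
  have := expValue_le hD.lam_nonneg hD.p_nonneg (hD.extend hT) s₀ π k
  have hk' : (0 : ℝ) < k := by exact_mod_cast hk
  rw [averageValue_eq, div_le_iff₀ hk', add_mul, div_mul_cancel₀ _ hk'.ne', mul_comm]
  exact this

theorem DualFeasible.extendedValue_nonneg {D : DualPoint n} (hD : I.DualFeasible M T D) :
    0 ≤ I.extendedValue M T D := by
  refine add_nonneg (mul_nonneg (Nat.cast_nonneg M) hD.lam_nonneg) (sum_nonneg fun i _ => ?_)
  have := hD.h_nonneg i
  have := hD.p_nonneg i
  have := I.c_nonneg i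
  positivity

theorem eventually_add_div_lt (a C : ℝ) {δ : ℝ} (hδ : 0 < δ) :
    ∀ᶠ k : ℕ in atTop, 0 < k ∧ a + C / k < a + δ := by
  have h : Tendsto (fun k : ℕ => C / k) atTop (nhds 0) := tendsto_const_div_atTop_nhds_zero_nat C
  filter_upwards [h.eventually_lt_const hδ, eventually_gt_atTop 0] with k h1 h2
  exact ⟨h2, by linarith⟩

theorem DualFeasible.achievable_le {D : DualPoint n} (hD : I.DualFeasible M T D) (hT : 1 ≤ T)
    {w : ℝ} (hw : w ∈ I.achievableValues M) : w ≤ I.extendedValue M T D := by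
  obtain ⟨π, s₀, rfl⟩ := hw
  obtain ⟨C, hC⟩ := hD.averageValue_le hT π s₀
  refine le_of_forall_pos_le_add fun δ hδ => ?_
  have hmem : ∀ᶠ k in atTop, I.averageValue π s₀ k ≤ I.extendedValue M T D + δ := by
    filter_upwards [eventually_add_div_lt (I.extendedValue M T D) C hδ] with k hk
    exact (hC k hk.1).trans hk.2.le
  rw [limsup_eq]
  -- If this set is unbounded below, its `sInf` is the default value 0, still at most the
  -- nonnegative bound.
  by_cases hb : BddBelow {a | ∀ᶠ k in atTop, I.averageValue π s₀ k ≤ a}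
  · exact csInf_le hb hmem
  · rw [Real.sInf_of_not_bddBelow hb]
    linarith [hD.extendedValue_nonneg]

theorem bddAbove_achievableValues (I : ProbeBandit n) (hM : 1 ≤ M) :
    BddAbove (I.achievableValues M) := by
  obtain ⟨D, hD⟩ := exists_dualFeasible I hM 1
  exact ⟨_, fun _ hw => hD.achievable_le le_rfl hw⟩

/-- The optimal value is not much larger than the value of the dual with a large horizon. -/
theorem exists_horizon (I : ProbeBandit n) (M : ℕ) {ε : ℝ} (hε : 0 < ε) :
    ∃ T₀ : ℕ, 1 ≤ T₀ ∧ ∀ T ≥ T₀, ∀ D, I.DualFeasible M T D →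
      I.optimalValue M / (2 + ε) ≤ M * D.lam := by
  rcases le_or_gt (I.optimalValue M) 0 with hO | hO
  · refine ⟨1, le_rfl, fun T _ D hD => ?_⟩
    exact (div_nonpos_of_nonpos_of_nonneg hO (by linarith)).trans
      (mul_nonneg (Nat.cast_nonneg M) hD.lam_nonneg)
  let K : ℝ := ∑ i, 1 / I.α i
  let K' : ℝ := ∑ i, (I.c i + I.c i / I.α i)
  have hK : ∀ i, 1 / I.α i ≤ K := fun i =>
    single_le_sum (f := fun i => 1 / I.α i) (fun j _ => (one_div_pos.2 (I.α_pos j)).le) (mem_univ i)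
  -- With this δ, (2 + δ)/(1 − δ) = 2 + 3ε/4. The horizon makes both K/T < δ and K'/T < δ OPT; the
  -- latter needs OPT > 0.
  let δ := ε / (4 + ε)
  have hδ : 0 < δ := by positivity
  have hδO : 0 < δ * I.optimalValue M := mul_pos hδ hO
  obtain ⟨T₀, hT₀⟩ := eventually_atTop.1
    ((eventually_add_div_lt 0 K hδ).and (eventually_add_div_lt 0 K' hδO))
  refine ⟨max 1 T₀, le_max_left _ _, fun T hT D hD => ?_⟩
  have hT1 : 1 ≤ T := (le_max_left _ _).trans hT
  obtain ⟨⟨-, h1⟩, -, h2⟩ := hT₀ T ((le_max_right _ _).trans hT)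
  simp only [zero_add] at h1 h2
  have hT' : (0 : ℝ) < T := by exact_mod_cast hT1
  have hopt : I.optimalValue M ≤ I.extendedValue M T D :=
    Real.sSup_le (fun w hw => hD.achievable_le hT1 hw) hD.extendedValue_nonneg
  have hext : I.extendedValue M T D ≤ 2 * (M * D.lam) + (K * (M * D.lam) + K') / T := by
    unfold extendedValue
    rw [sum_add_distrib, ← hD.balance, ← sum_div]
    have : ∑ i, (I.c i + D.p i) ≤ K * (M * D.lam) + K' := by
      rw [hD.balance, mul_sum, ← sum_add_distrib]
      refine sum_le_sum fun i _ => ?_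
      have h3 := hD.p_le hT1 i
      have h4 := mul_le_mul_of_nonneg_right (hK i) (hD.h_nonneg i)
      rw [add_div] at h3
      rw [one_div_mul_eq_div] at h4
      linarith
    have := div_le_div_of_nonneg_right this hT'.le
    linarith
  have hlam : 0 ≤ M * D.lam := mul_nonneg (Nat.cast_nonneg M) hD.lam_nonneg
  rw [add_div, mul_div_right_comm] at hext
  have h5 := mul_le_mul_of_nonneg_right h1.le hlam
  have h6 : (1 - δ) * I.optimalValue M ≤ (2 + δ) * (M * D.lam) := by linarith
  have h7 : 1 - δ = 4 / (4 + ε) := by simp only [δ]; field_simp; ring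
  have h8 : 2 + δ ≤ 2 * (2 + ε) * 2 / (4 + ε) := by
    simp only [δ]
    rw [le_div_iff₀ (by positivity), add_mul, div_mul_cancel₀ _ (by positivity)]
    linarith
  rw [div_le_iff₀ (by positivity)]
  have h9 := h6.trans (mul_le_mul_of_nonneg_right h8 hlam)
  rw [h7, div_mul_eq_mul_div, div_mul_eq_mul_div, div_le_div_iff_of_pos_right (by positivity)] at h9
  linarith

end ProbeBandit

/-! ### Invariants of executions of the two-stage policy -/

/-- An arm of the two-stage policy is in a situation that the stages allow. -/
def StageInvariant {n : ℕ} (q : StageParams n) (s₀ : Fin n → Bool) (h : History n) (i : Fin n) :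
    Prop :=
  match phase s₀ h i with
  | .waiting y => lastObs s₀ h i = false ∧ age h i = y
  | .trying j => lastObs s₀ h i = false ∧ q.d i - q.m i + j ≤ age h i ∧ j ≤ q.m i
  | .exploiting j => lastObs s₀ h i = true ∧ age h i = j ∧ j ≤ q.e i

namespace StageParams
variable {n : ℕ} {q : StageParams n} {s₀ : Fin n → Bool} {h : History n} {i : Fin n}

theorem mem_busy_iff : i ∈ q.busy s₀ h ↔
    i ∈ q.S ∧ ∃ j, phase s₀ h i = .trying j ∨ phase s₀ h i = .exploiting j := by
  simp only [busy, mem_filter]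

theorem mem_busy_of_trying {j : ℕ} (hi : i ∈ q.S) (hj : phase s₀ h i = .trying j) :
    i ∈ q.busy s₀ h :=
  mem_busy_iff.2 ⟨hi, j, .inl hj⟩

theorem mem_busy_of_exploiting {j : ℕ} (hi : i ∈ q.S) (hj : phase s₀ h i = .exploiting j) :
    i ∈ q.busy s₀ h :=
  mem_busy_iff.2 ⟨hi, j, .inr hj⟩

theorem not_mem_busy_of_waiting {y : ℕ} (hy : phase s₀ h i = .waiting y) : i ∉ q.busy s₀ h := by
  simp [mem_busy_iff, hy]

theorem mem_ready_iff_of_waiting {y : ℕ} (hy : phase s₀ h i = .waiting y) :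
    i ∈ q.ready s₀ h ↔ i ∈ q.S ∧ q.d i - q.m i ≤ y := by
  simp [ready, hy]

theorem exists_waiting_of_mem_ready (hi : i ∈ q.ready s₀ h) :
    i ∈ q.S ∧ ∃ y, phase s₀ h i = .waiting y ∧ q.d i - q.m i ≤ y := by
  simp only [ready, mem_filter] at hi
  exact hi

theorem PlayRule.subset {M : ℕ} {A : Finset (Fin n)} (hA : q.PlayRule s₀ M h A) : A ⊆ q.S := by
  intro i hi
  by_cases hb : i ∈ q.busy s₀ h
  · exact (mem_busy_iff.1 hb).1
  · exact (exists_waiting_of_mem_ready (hA.2.1 i hi hb).1).1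

theorem stageInvariant_nil : StageInvariant q s₀ [] i := by
  simp only [StageInvariant, phase, lastObs, age]
  cases s₀ i <;> simp

theorem stageInvariant_probed {g : Bool} {a : Fin n} (hi : StageInvariant q s₀ h i) :
    StageInvariant q s₀ (.probed a g :: h) i := by
  by_cases hia : i = a
  · simp only [StageInvariant, phase, lastObs, age, if_pos hia]
    cases g <;> simp
  · simpa only [StageInvariant, phase, lastObs, age, if_neg hia] using hi

theorem stageInvariant_played {M : ℕ} {A : Finset (Fin n)} (hA : q.PlayRule s₀ M h A)
    (hiS : i ∈ q.S) (hi : StageInvariant q s₀ h i) (hdue : ¬ q.Due s₀ h i) :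
    StageInvariant q s₀ (.played A :: h) i := by
  unfold StageInvariant at hi ⊢
  simp only [phase, lastObs, age]
  cases hp : phase s₀ h i with
  | waiting y =>
    simp only [hp] at hi
    by_cases hiA : i ∈ A
    · obtain ⟨hr, hm⟩ := hA.2.1 i hiA (not_mem_busy_of_waiting hp)
      have := ((mem_ready_iff_of_waiting hp).1 hr).2
      simp only [if_pos hiA]
      exact ⟨hi.1, by omega, hm⟩
    · simp only [if_neg hiA]
      exact ⟨hi.1, by omega⟩
  | trying j =>
    simp only [hp] at hi ⊢
    have : j ≠ q.m i := fun hj => hdue ⟨hiS, .inl (hj ▸ hp)⟩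
    exact ⟨hi.1, by omega, by omega⟩
  | exploiting j =>
    simp only [hp] at hi ⊢
    have : j ≠ q.e i := fun hj => hdue ⟨hiS, .inr (hj ▸ hp)⟩
    exact ⟨hi.1, by omega, by omega⟩

theorem age_pos_of_due (hi : StageInvariant q s₀ h i) (hd : 1 ≤ q.d i) (he : 1 ≤ q.e i)
    (hdue : q.Due s₀ h i) : age h i ≠ 0 := by
  unfold StageInvariant at hi
  rcases hdue.2 with hp | hp <;> simp only [hp] at hi <;> omega

/-- No arm is probed twice in one time step: a probe resets the age to 0, and an arm of age 0 cannot
be due, nor ready with `m = 0`. So `n` probes always suffice, and no due arm is left when they are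
used up. -/
theorem age_pos_of_probeRule {M : ℕ} (hi : i ∈ q.S → StageInvariant q s₀ h i)
    (hd : i ∈ q.S → 1 ≤ q.d i) (he : i ∈ q.S → 1 ≤ q.e i) (hr : q.ProbeRule s₀ M h (some i)) :
    i ∈ q.S ∧ age h i ≠ 0 := by
  rcases hr with hdue | ⟨hr, hm, -⟩
  · exact ⟨hdue.1, age_pos_of_due (hi hdue.1) (hd hdue.1) (he hdue.1) hdue⟩
  · obtain ⟨hS, y, hp, hy⟩ := exists_waiting_of_mem_ready hr
    have h1 := hi hS
    have h2 := hd hS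
    simp only [StageInvariant, hp] at h1
    exact ⟨hS, by omega⟩

/-- The number of arms that have just been observed increases with each probe. -/
theorem card_age_eq_zero_probed {g : Bool} (hi : age h i ≠ 0) :
    #{j | age (.probed i g :: h) j = 0} = #{j | age h j = 0} + 1 := by
  have : ({j | age (.probed i g :: h) j = 0} : Finset (Fin n)) =
      insert i ({j | age h j = 0} : Finset (Fin n)) := by
    ext j
    by_cases hj : j = i <;> simp [age, hj]
  rw [this, card_insert_of_notMem (by simpa using hi)]

theorem card_age_eq_zero_played {A : Finset (Fin n)} :
    #{j | age (.played A :: h) j = 0} = 0 := by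
  simp [age]

/-- What holds at a decision point of an execution of the two-stage policy. -/
def DecisionInvariant (q : StageParams n) (s₀ : Fin n → Bool) (o : Option ℕ) (h : History n) :
    Prop :=
  (∀ i ∈ q.S, StageInvariant q s₀ h i) ∧
    match o with
    | none => ∀ i, ¬ q.Due s₀ h i
    | some k => #{j | age h j = 0} + k = n

theorem DecisionInvariant.age_eq_zero (hinv : q.DecisionInvariant s₀ (some 0) h) (i : Fin n) :
    age h i = 0 := by
  have h1 := hinv.2
  simp only [add_zero] at h1
  have h2 : ({j | age h j = 0} : Finset (Fin n)) = univ :=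
    eq_univ_of_card _ (by rw [h1, Fintype.card_fin])
  have h3 : i ∈ ({j | age h j = 0} : Finset (Fin n)) := by
    rw [h2]
    exact mem_univ i
  simpa using h3

theorem not_due_of_card (hd : ∀ i ∈ q.S, 1 ≤ q.d i) (he : ∀ i ∈ q.S, 1 ≤ q.e i)
    (hinv : q.DecisionInvariant s₀ (some 0) h) (i : Fin n) : ¬ q.Due s₀ h i := fun hdue =>
  age_pos_of_due (hinv.1 i hdue.1) (hd i hdue.1) (he i hdue.1) hdue (hinv.age_eq_zero i)

theorem DecisionInvariant.start (he : ∀ i ∈ q.S, 1 ≤ q.e i) :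
    q.DecisionInvariant s₀ none [] := by
  refine ⟨fun i _ => stageInvariant_nil, fun i hdue => ?_⟩
  have := he i hdue.1
  rcases hdue.2 with hp | hp <;> simp only [phase] at hp <;> split_ifs at hp
  simp only [Phase.exploiting.injEq] at hp
  omega

theorem DecisionInvariant.play {M : ℕ} {A : Finset (Fin n)}
    (hinv : q.DecisionInvariant s₀ none h) (hA : q.PlayRule s₀ M h A) :
    q.DecisionInvariant s₀ (some n) (.played A :: h) := by
  refine ⟨fun i hi => stageInvariant_played hA hi (hinv.1 i hi) (hinv.2 i), ?_⟩
  simp only [card_age_eq_zero_played, zero_add]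

theorem DecisionInvariant.probe {M k : ℕ} (hd : ∀ i ∈ q.S, 1 ≤ q.d i)
    (he : ∀ i ∈ q.S, 1 ≤ q.e i) (hinv : q.DecisionInvariant s₀ (some (k + 1)) h)
    (hr : q.ProbeRule s₀ M h (some i)) (g : Bool) :
    q.DecisionInvariant s₀ (some k) (.probed i g :: h) := by
  have := (age_pos_of_probeRule (hinv.1 _) (hd _) (he _) hr).2
  refine ⟨fun i hi => stageInvariant_probed (hinv.1 i hi), ?_⟩
  have h2 := hinv.2
  simp only [card_age_eq_zero_probed this] at h2 ⊢
  omega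

theorem DecisionInvariant.last (hd : ∀ i ∈ q.S, 1 ≤ q.d i) (he : ∀ i ∈ q.S, 1 ≤ q.e i)
    (hinv : q.DecisionInvariant s₀ (some 0) h) : q.DecisionInvariant s₀ none h :=
  ⟨hinv.1, not_due_of_card hd he hinv⟩

theorem decisionInvariant {M : ℕ} {π : Policy n M} (hd : ∀ i ∈ q.S, 1 ≤ q.d i)
    (he : ∀ i ∈ q.S, 1 ≤ q.e i) (hπ : IsTwoStage q s₀ π) {o : Option ℕ} (hv : Visits π o h) :
    q.DecisionInvariant s₀ o h := by
  induction hv with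
  | start => exact .start he
  | play hv hA ih => exact ih.play (hπ.1 _ hv _ hA)
  | probe good hv hp ih => exact ih.probe hd he (hπ.2 _ _ hv _ hp) good
  | finish hv hp ih => exact ⟨ih.1, hπ.2 _ _ hv _ hp⟩
  | last hv ih => exact ih.last hd he

end StageParams

/-! ### Lower bound on the value of the two-stage policy -/

namespace ProbeBandit
variable {n : ℕ} {I : ProbeBandit n} {M : ℕ}

/-- Potential of an arm in the two-stage policy. -/
def stageValue (I : ProbeBandit n) (lam h p : ℝ) (i : Fin n) (d m : ℕ) : Phase → ℝ
  | .waiting y => (min y (d - m) : ℕ) * h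
  | .trying j => (d - m + j : ℕ) * h - ∑ l ∈ range j, (I.R i false (d - m + l + 1) - lam)
  | .exploiting j => p + j * h - ∑ l ∈ range j, (I.R i true (l + 1) - lam)

variable {lam : ℝ} {h p : Fin n → ℝ} {q : StageParams n} {s₀ : Fin n → Bool} {H : History n}
  {i : Fin n}

/-- For the lower bound (`σ = -1`) the potential must be bounded above at the end; the invariant
limits all counters. -/
theorem stageValue_le (hlam : 0 ≤ lam)
    (ht : I.TightStages lam (h i) (p i) i (q.d i) (q.e i) (q.m i))
    (hinv : StageInvariant q s₀ H i) :
    I.stageValue lam (h i) (p i) i (q.d i) (q.m i) (phase s₀ H i) ≤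
      p i + (q.d i + q.e i) * (h i + lam) := by
  have hh := ht.h_nonneg
  have hp := ht.p_nonneg
  have hR : ∀ s t, 0 ≤ I.R i s t := by
    intro s t
    refine mul_nonneg (I.r_nonneg i) ?_
    split_ifs
    · exact I.u_nonneg i t
    · exact I.v_nonneg i t
  have hsum : ∀ (f : ℕ → ℝ) (j N : ℕ), (∀ l, 0 ≤ f l) → j ≤ N →
      -∑ l ∈ range j, (f l - lam) ≤ N * lam := by
    intro f j N hf hj
    rw [sum_sub_distrib, sum_const, card_range, nsmul_eq_mul]
    have h1 := sum_nonneg fun l (_ : l ∈ range j) => hf l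
    have h2 : (j : ℝ) ≤ N := by exact_mod_cast hj
    have := mul_le_mul_of_nonneg_right h2 hlam
    linarith
  have hcoe : ∀ a b : ℕ, a ≤ b → (a : ℝ) * h i ≤ b * h i := fun a b hab =>
    mul_le_mul_of_nonneg_right (by exact_mod_cast hab) hh
  have h1 : 0 ≤ (q.e i : ℝ) * h i := by positivity
  have h2 : 0 ≤ (q.d i : ℝ) * h i := by positivity
  have h3 : 0 ≤ (q.e i : ℝ) * lam := by positivity
  have h4 : 0 ≤ (q.d i : ℝ) * lam := by positivity
  have hmd := ht.m_le_d
  unfold StageInvariant at hinv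
  cases hph : phase s₀ H i with
  | waiting y =>
    simp only [stageValue]
    have := hcoe (min y (q.d i - q.m i)) (q.d i) (by omega)
    linarith
  | trying j =>
    simp only [hph] at hinv
    simp only [stageValue]
    have := hcoe (q.d i - q.m i + j) (q.d i) (by omega)
    have := hsum (fun l => I.R i false (q.d i - q.m i + l + 1)) j (q.d i) (fun _ => hR _ _)
      (by omega)
    linarith
  | exploiting j =>
    simp only [hph] at hinv
    simp only [stageValue]
    have := hcoe j (q.e i) hinv.2.2
    have := hsum (fun l => I.R i true (l + 1)) j (q.e i) (fun _ => hR _ _) hinv.2.2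
    linarith

/-- A probe that the rules allow does not decrease the potential of the arm. -/
theorem stageValue_probe (ht : I.TightStages lam (h i) (p i) i (q.d i) (q.e i) (q.m i))
    (hinv : StageInvariant q s₀ H i) (hr : q.ProbeRule s₀ M H (some i)) :
    I.stageValue lam (h i) (p i) i (q.d i) (q.m i) (phase s₀ H i) ≤
      -I.c i + I.probeProb s₀ H i true * p i := by
  have hmd := ht.m_le_d
  -- A ready arm may have waited for a place longer than necessary. Its chance of being good has
  -- only grown since `d`, which favours the probe.
  have hv : ∀ t, q.d i ≤ t → I.v i (q.d i) * p i ≤ I.v i t * p i := fun t h =>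
    mul_le_mul_of_nonneg_right (I.v_mono i h) ht.p_nonneg
  unfold StageInvariant at hinv
  rcases hr with ⟨-, hph | hph⟩ | ⟨hr, hm, -⟩
  · simp only [hph] at hinv
    have := hv (age H i) (by omega)
    have hb := ht.bad
    have e : q.d i - q.m i + q.m i = q.d i := by omega
    simp only [hph, stageValue, probeProb, stateProb, hinv.1, if_true, Bool.false_eq_true, if_false,
      e]
    linarith
  · simp only [hph] at hinv
    have hg := ht.good
    simp only [hph, stageValue, probeProb, stateProb, hinv.1, if_true, hinv.2.1]
    linarith
  · obtain ⟨-, y, hph, hy⟩ := StageParams.exists_waiting_of_mem_ready hr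
    simp only [hph] at hinv
    have := hv (age H i) (by omega)
    have hb := ht.bad
    simp only [hm, range_zero, sum_empty, add_zero] at hb
    have e : min y (q.d i - 0) = q.d i := by omega
    simp only [hph, stageValue, probeProb, stateProb, hinv.1, if_true, Bool.false_eq_true, if_false,
      hm, e]
    linarith

/-- A time step brings an arm `lam + h` if the arm is played, and `h` if it is not ready. -/
theorem stageValue_play {A : Finset (Fin n)} (hiS : i ∈ q.S)
    (ht : I.TightStages lam (h i) (p i) i (q.d i) (q.e i) (q.m i))
    (hinv : StageInvariant q s₀ H i) (hA : q.PlayRule s₀ M H A) :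
    I.stageValue lam (h i) (p i) i (q.d i) (q.m i) (phase s₀ H i) +
      (if i ∈ A then lam else 0) + (if i ∈ q.ready s₀ H \ A then 0 else h i) ≤
      (if i ∈ A then I.R i (lastObs s₀ H i) (age H i + 1) else 0) +
      I.stageValue lam (h i) (p i) i (q.d i) (q.m i) (phase s₀ (.played A :: H) i) := by
  have hh := ht.h_nonneg
  unfold StageInvariant at hinv
  cases hph : phase s₀ H i with
  | waiting y =>
    simp only [hph] at hinv
    by_cases hiA : i ∈ A
    · have hr := (hA.2.1 i hiA (StageParams.not_mem_busy_of_waiting hph)).1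
      have hy := ((StageParams.mem_ready_iff_of_waiting hph).1 hr).2
      -- The potential charges the reward of the earliest possible play; a later play earns at least
      -- as much.
      have hR := I.R_false_mono i (show q.d i - q.m i + 1 ≤ age H i + 1 by omega)
      have e : min y (q.d i - q.m i) = q.d i - q.m i := by omega
      simp only [phase, hph, stageValue, hiA, if_true, Finset.mem_sdiff, not_true_eq_false, and_false,
        if_false, hinv.1, e, sum_range_one, add_zero]
      push_cast
      linarith
    · simp only [phase, hph, hiA, if_false, Finset.mem_sdiff, not_false_eq_true, and_true, stageValue,
        StageParams.mem_ready_iff_of_waiting hph, hiS, true_and]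
      split_ifs with hy
      · have e1 : min y (q.d i - q.m i) = q.d i - q.m i := by omega
        have e2 : min (y + 1) (q.d i - q.m i) = q.d i - q.m i := by omega
        rw [e1, e2]
        linarith
      · have e1 : min y (q.d i - q.m i) = y := by omega
        have e2 : min (y + 1) (q.d i - q.m i) = y + 1 := by omega
        rw [e1, e2]
        push_cast
        linarith
  | trying j =>
    simp only [hph] at hinv
    have hiA := hA.1 (StageParams.mem_busy_of_trying hiS hph)
    have hR := I.R_false_mono i (show q.d i - q.m i + j + 1 ≤ age H i + 1 by omega)
    simp only [phase, hph, stageValue, hiA, if_true, Finset.mem_sdiff, not_true_eq_false, and_false,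
      if_false, hinv.1, sum_range_succ]
    push_cast
    linarith
  | exploiting j =>
    simp only [hph] at hinv
    have hiA := hA.1 (StageParams.mem_busy_of_exploiting hiS hph)
    simp only [phase, hph, stageValue, hiA, if_true, Finset.mem_sdiff, not_true_eq_false, and_false,
      if_false, hinv.1, hinv.2.1, sum_range_succ]
    push_cast
    linarith

theorem le_expValue_of_isTwoStage {π : Policy n M} (hlam : 0 ≤ lam)
    (hbal : M * lam = ∑ i ∈ q.S, h i)
    (ht : ∀ i ∈ q.S, I.TightStages lam (h i) (p i) i (q.d i) (q.e i) (q.m i))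
    (hπ : IsTwoStage q s₀ π) : ∃ C, ∀ k : ℕ, k * (M * lam) + C ≤ I.expValue s₀ π k [] := by
  have hinv : ∀ {o H}, Visits π o H → q.DecisionInvariant s₀ o H := fun hv =>
    StageParams.decisionInvariant (fun i hi => (ht i hi).one_le_d) (fun i hi => (ht i hi).one_le_e)
      hπ hv
  let F : History n → ℝ := fun H =>
    ∑ i ∈ q.S, I.stageValue lam (h i) (p i) i (q.d i) (q.m i) (phase s₀ H i)
  let K := ∑ i ∈ q.S, (p i + (q.d i + q.e i) * (h i + lam))
  have main := I.expValue_potential (s₀ := s₀) (π := π) F (-1) (M * lam) K ?_ ?_ ?_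
  · refine ⟨F [] - K, fun k => ?_⟩
    have := main k [] .start
    linarith
  · intro H hv A hA
    have hrule := hπ.1 H hv A hA
    have hsub := hrule.subset
    have h1 := sum_le_sum fun i hi => stageValue_play hi (ht i hi) ((hinv hv).1 i hi) hrule
    simp only [sum_add_distrib, sum_ite_mem, inter_eq_right.2 hsub, sum_const, nsmul_eq_mul] at h1
    -- Either `M` plays bring λ each, or no ready arm is idle and every arm of `S` brings `h`;
    -- balance makes both totals Mλ.
    have h2 : M * lam ≤ A.card * lam +
        ∑ i ∈ q.S, if i ∈ q.ready s₀ H \ A then 0 else h i := by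
      rcases (π.card_le H A hA).eq_or_lt with hc | hc
      · rw [hc]
        have : 0 ≤ ∑ i ∈ q.S, if i ∈ q.ready s₀ H \ A then 0 else h i := sum_nonneg fun i hi => by
          split_ifs
          · exact le_rfl
          · exact (ht i hi).h_nonneg
        linarith
      · have he : q.ready s₀ H \ A = ∅ := sdiff_eq_empty_iff_subset.2 (hrule.2.2 hc)
        simp only [he, notMem_empty, if_false]
        have : 0 ≤ A.card * lam := by positivity
        linarith
    simp only [F]
    linarith
  · intro k H hv i hi
    have hrule := hπ.2 k H hv _ hi
    have hiS : i ∈ q.S := (StageParams.age_pos_of_probeRule ((hinv hv).1 i)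
      (fun hi => (ht i hi).one_le_d) (fun hi => (ht i hi).one_le_e) hrule).1
    have h1 := stageValue_probe (ht i hiS) ((hinv hv).1 i hiS) hrule
    have h2 : ∑ g, I.probeProb s₀ H i g = 1 := I.sum_stateProb _ _ _
    have e : ∀ g, F (.probed i g :: H) = (if g then p i else 0) +
        ∑ j ∈ q.S.erase i, I.stageValue lam (h j) (p j) j (q.d j) (q.m j) (phase s₀ H j) := by
      intro g
      simp only [F]
      rw [← add_sum_erase _ _ hiS]
      congr 1
      · cases g <;> simp [phase, stageValue]
      · refine sum_congr rfl fun j hj => ?_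
        simp only [phase, if_neg (ne_of_mem_erase hj)]
    have e' : F H = I.stageValue lam (h i) (p i) i (q.d i) (q.m i) (phase s₀ H i) +
        ∑ j ∈ q.S.erase i, I.stageValue lam (h j) (p j) j (q.d j) (q.m j) (phase s₀ H j) :=
      (add_sum_erase _ _ hiS).symm
    rw [Fintype.sum_bool] at h2 ⊢
    have h3 : I.probeProb s₀ H i false = 1 - I.probeProb s₀ H i true := by linarith
    rw [e, e, e', h3]
    simp only [if_true, Bool.false_eq_true, if_false]
    linarith
  · intro H hv
    have := sum_le_sum fun i hi => stageValue_le hlam (ht i hi) ((hinv hv).1 i hi)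
    simp only [F, K]
    linarith

end ProbeBandit
-- Existence of an execution
namespace StageParams
variable {n M : ℕ} {q : StageParams n} {s₀ : Fin n → Bool} {h : History n}

/-- What holds, in addition, at the decision points of an execution that leaves no ready arm with
`m = 0` behind as long as there are free places. -/
def PlaceInvariant (q : StageParams n) (s₀ : Fin n → Bool) (M : ℕ) (o : Option ℕ) (h : History n) :
    Prop :=
  q.DecisionInvariant s₀ o h ∧ (q.busy s₀ h).card ≤ M ∧
    (o = none → (q.busy s₀ h).card < M → ∀ i ∈ q.ready s₀ h, 0 < q.m i)

theorem exists_playRule (hinv : q.PlaceInvariant s₀ M none h) :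
    ∃ A : Finset (Fin n), A.card ≤ M ∧ q.PlayRule s₀ M h A := by
  -- All arms that may be played. If there are more than `M`, drop some that are not busy; otherwise
  -- play all, and the invariant ensures that no ready arm with `m = 0` is left when places are
  -- free.
  let B := q.busy s₀ h ∪ {i ∈ q.ready s₀ h | 0 < q.m i}
  have hrule : ∀ A ⊆ B, ∀ i ∈ A, i ∉ q.busy s₀ h → i ∈ q.ready s₀ h ∧ 0 < q.m i := by
    intro A hA i hi hb
    simpa [B, hb] using hA hi
  rcases le_or_gt B.card M with hB | hB
  · refine ⟨B, hB, subset_union_left, hrule B le_rfl, fun hlt i hi => ?_⟩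
    have := hinv.2.2 rfl ((card_le_card subset_union_left).trans_lt hlt) i hi
    simp [B, hi, this]
  · obtain ⟨A, h1, h2, h3⟩ := exists_subsuperset_card_eq
      (subset_union_left : q.busy s₀ h ⊆ B) hinv.2.1 hB.le
    exact ⟨A, h3.le, h1, hrule A h2, fun hlt => by omega⟩

theorem busy_played_subset {A : Finset (Fin n)} (hA : q.PlayRule s₀ M h A) :
    q.busy s₀ (.played A :: h) ⊆ A := by
  intro i hi
  by_contra hiA
  simp only [mem_busy_iff, phase] at hi
  obtain ⟨hiS, j, hj⟩ := hi
  cases hp : phase s₀ h i with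
  | waiting y => simp [hp, hiA] at hj
  | trying j => exact hiA (hA.1 (mem_busy_of_trying hiS hp))
  | exploiting j => exact hiA (hA.1 (mem_busy_of_exploiting hiS hp))

/-- A due arm already occupies a place, and any other arm is probed only when a place is free. -/
theorem card_busy_probed_le {i : Fin n} {g : Bool} (hr : q.ProbeRule s₀ M h (some i))
    (hle : (q.busy s₀ h).card ≤ M) : (q.busy s₀ (.probed i g :: h)).card ≤ M := by
  have hsub : q.busy s₀ (.probed i g :: h) ⊆ insert i (q.busy s₀ h) := by
    intro j hj
    by_cases hji : j = i
    · exact hji ▸ mem_insert_self _ _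
    · simp only [mem_busy_iff, phase, if_neg hji] at hj
      exact mem_insert_of_mem (mem_busy_iff.2 hj)
  refine (card_le_card hsub).trans ?_
  rcases hr with ⟨hS, hp⟩ | ⟨-, -, hlt⟩
  · have : i ∈ q.busy s₀ h := by
      rcases hp with hp | hp
      · exact mem_busy_of_trying hS hp
      · exact mem_busy_of_exploiting hS hp
    rwa [insert_eq_of_mem this]
  · exact (card_insert_le _ _).trans hlt

theorem placeInvariant {π : Policy n M} (hd : ∀ i ∈ q.S, 1 ≤ q.d i) (he : ∀ i ∈ q.S, 1 ≤ q.e i)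
    (hcard : #{i ∈ q.S | s₀ i = true} ≤ M)
    (hplay : ∀ h, (∃ A : Finset (Fin n), A.card ≤ M ∧ q.PlayRule s₀ M h A) →
      ∀ A ∈ (π.play h).support, q.PlayRule s₀ M h A)
    (hprobe : ∀ h, ∀ o ∈ (π.probe h).support, q.ProbeRule s₀ M h o)
    (hnone : ∀ h, none ∈ (π.probe h).support → (q.busy s₀ h).card < M →
      ∀ i ∈ q.ready s₀ h, 0 < q.m i)
    {o : Option ℕ} (hv : Visits π o h) : q.PlaceInvariant s₀ M o h := by
  -- A ready arm of age 0 has `m ≥ d ≥ 1`. This covers the start and the case where all probes have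
  -- been used.
  have hfresh : ∀ {h : History n} {o}, q.DecisionInvariant s₀ o h → (∀ i, age h i = 0) →
      ∀ i ∈ q.ready s₀ h, 0 < q.m i := by
    intro h o hinv h0 i hi
    obtain ⟨hS, y, hp, hy⟩ := exists_waiting_of_mem_ready hi
    have h1 := hinv.1 i hS
    simp only [StageInvariant, hp] at h1
    have := hd i hS
    have := h0 i
    omega
  induction hv with
  | start =>
    have h0 := DecisionInvariant.start (s₀ := s₀) he
    refine ⟨h0, le_trans (card_le_card fun i hi => ?_) hcard, fun _ _ => hfresh h0 fun i => rfl⟩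
    simp only [mem_busy_iff, phase] at hi
    obtain ⟨hS, j, hj⟩ := hi
    rw [mem_filter]
    refine ⟨hS, ?_⟩
    by_contra hs
    simp [hs] at hj
  | play hv hA ih =>
    have hr := hplay _ (exists_playRule ih) _ hA
    exact ⟨ih.1.play hr, (card_le_card (busy_played_subset hr)).trans (π.card_le _ _ hA),
      fun h => by cases h⟩
  | probe good hv hp ih =>
    have hr := hprobe _ _ hp
    exact ⟨ih.1.probe hd he hr good, card_busy_probed_le hr ih.2.1, fun h => by cases h⟩
  | finish hv hp ih => exact ⟨⟨ih.1.1, hprobe _ _ hp⟩, ih.2.1, fun _ => hnone _ hp⟩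
  | last hv ih =>
    exact ⟨ih.1.last hd he, ih.2.1, fun _ _ => hfresh ih.1 ih.1.age_eq_zero⟩

/-- The two-stage policy can be executed. -/
theorem exists_isTwoStage (hd : ∀ i ∈ q.S, 1 ≤ q.d i) (he : ∀ i ∈ q.S, 1 ≤ q.e i)
    (hcard : #{i ∈ q.S | s₀ i = true} ≤ M) : ∃ π : Policy n M, IsTwoStage q s₀ π := by
  -- A policy must be defined on all histories; where no admissible set exists it plays nothing, and
  -- the invariant shows that such histories are not reached.
  have hA : ∀ h, ∃ A : Finset (Fin n), A.card ≤ M ∧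
      ((∃ A : Finset (Fin n), A.card ≤ M ∧ q.PlayRule s₀ M h A) → q.PlayRule s₀ M h A) := by
    intro h
    by_cases hex : ∃ A : Finset (Fin n), A.card ≤ M ∧ q.PlayRule s₀ M h A
    · obtain ⟨A, h1, h2⟩ := hex
      exact ⟨A, h1, fun _ => h2⟩
    · exact ⟨∅, by simp, fun h => (hex h).elim⟩
  -- Probe as long as any probe is permitted. Stopping then leaves no due arm and, if places are
  -- free, no ready arm with `m = 0`.
  have hO : ∀ h, ∃ o : Option (Fin n), q.ProbeRule s₀ M h o ∧
      (o = none → (q.busy s₀ h).card < M → ∀ i ∈ q.ready s₀ h, 0 < q.m i) := by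
    intro h
    by_cases hex : ∃ i, q.ProbeRule s₀ M h (some i)
    · obtain ⟨i, hi⟩ := hex
      exact ⟨some i, hi, fun h => by cases h⟩
    · push Not at hex
      refine ⟨none, fun i hi => hex i (.inl hi), fun _ hlt i hi => ?_⟩
      by_contra hm
      exact hex i (.inr ⟨hi, by omega, hlt⟩)
  choose A hA1 hA2 using hA
  choose o ho1 ho2 using hO
  let π : Policy n M := ⟨fun h => PMF.pure (A h), fun h => PMF.pure (o h), fun h B hB => by
    rw [PMF.mem_support_pure_iff] at hB
    exact hB ▸ hA1 h⟩
  have hplay : ∀ h, (∃ A : Finset (Fin n), A.card ≤ M ∧ q.PlayRule s₀ M h A) →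
      ∀ A ∈ (π.play h).support, q.PlayRule s₀ M h A := by
    intro h hex B hB
    rw [PMF.mem_support_pure_iff] at hB
    exact hB ▸ hA2 h hex
  have hprobe : ∀ h, ∀ o ∈ (π.probe h).support, q.ProbeRule s₀ M h o := by
    intro h o' ho
    rw [PMF.mem_support_pure_iff] at ho
    exact ho ▸ ho1 h
  have hnone : ∀ h, none ∈ (π.probe h).support → (q.busy s₀ h).card < M →
      ∀ i ∈ q.ready s₀ h, 0 < q.m i := by
    intro h ho
    rw [PMF.mem_support_pure_iff] at ho
    exact ho2 h ho.symm
  exact ⟨π, fun h hv => hplay h (exists_playRule (placeInvariant hd he hcard hplay hprobe hnone hv)),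
    fun _ h _ => hprobe h⟩

end StageParams

/-! ### Passage to the time average, and the theorem -/

namespace ProbeBandit
variable {n M T : ℕ} {I : ProbeBandit n}

theorem le_guaranteedValue {D : DualPoint n} (hD : I.DualFeasible M T D) (hT : 1 ≤ T)
    {π : Policy n M} {s₀ : Fin n → Bool} {κ C : ℝ}
    (h : ∀ k : ℕ, k * κ + C ≤ I.expValue s₀ π k []) : κ ≤ I.guaranteedValue π s₀ := by
  obtain ⟨C', hC'⟩ := hD.averageValue_le hT π s₀
  -- The upper bound from the dual keeps the real `liminf` from being a default value.
  have hbdd : IsCoboundedUnder (· ≥ ·) atTop (I.averageValue π s₀) := by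
    refine IsBoundedUnder.isCoboundedUnder_ge ⟨I.extendedValue M T D + 1, ?_⟩
    rw [eventually_map]
    filter_upwards [eventually_add_div_lt (I.extendedValue M T D) C' one_pos] with k hk
    exact (hC' k hk.1).trans hk.2.le
  refine le_of_forall_pos_sub_le fun δ hδ => le_liminf_of_le hbdd ?_
  filter_upwards [eventually_add_div_lt 0 (-C) hδ] with k hk
  have hk' : (0 : ℝ) < k := by exact_mod_cast hk.1
  have h1 := h k
  have h2 := hk.2
  rw [zero_add, zero_add, div_lt_iff₀ hk'] at h2
  rw [averageValue_eq, le_div_iff₀ hk', sub_mul]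
  linarith

end ProbeBandit
end

theorem mainTheorem9 {n : ℕ} (I : ProbeBandit n) (M : ℕ) (hM : 1 ≤ M) (ε : ℝ) (hε : 0 < ε) :
    BddAbove (I.achievableValues M) ∧
    ∃ T₀ : ℕ, ∀ T ≥ T₀,
      (∃ P, I.PrimalOptimal M T P) ∧ (∃ D, I.DualOptimal M T D) ∧
      ∀ (P : ProbeBandit.PrimalPoint n) (D : ProbeBandit.DualPoint n),
        I.PrimalOptimal M T P → I.DualOptimal M T D →
        (∀ i, 0 < D.h i →
          (∃ t ∈ Finset.Icc 1 T, 0 < P.z i true t) ∧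
          (∃ t ∈ Finset.Icc 1 T, 0 < P.z i false t)) ∧
        ∀ s₀ : Fin n → Bool, Finset.card {i | 0 < D.h i ∧ s₀ i = true} ≤ M →
          (∃ π : Policy n M, IsTwoStage (stageParams T P D) s₀ π) ∧
          ∀ π : Policy n M, IsTwoStage (stageParams T P D) s₀ π →
            I.optimalValue M / (2 + ε) ≤ I.guaranteedValue π s₀ := by
  refine ⟨ProbeBandit.bddAbove_achievableValues I hM, ?_⟩
  obtain ⟨T₀, hT₀, hopt⟩ := ProbeBandit.exists_horizon I M hε
  refine ⟨T₀, fun T hT => ?_⟩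
  have hT1 : 1 ≤ T := hT₀.trans hT
  obtain ⟨D₀, hD₀⟩ := ProbeBandit.exists_dualOptimal I hM hT1
  refine ⟨ProbeBandit.exists_primalOptimal hM hD₀, ⟨D₀, hD₀⟩, fun P D hP hD =>
    ⟨fun i hi => ProbeBandit.exists_probe_pos hM hP hD hi, fun s₀ hs₀ => ?_⟩⟩
  have ht : ∀ i ∈ (stageParams T P D).S, I.TightStages D.lam (D.h i) (D.p i) i
      ((stageParams T P D).d i) ((stageParams T P D).e i) ((stageParams T P D).m i) :=
    fun i hi => ProbeBandit.tightStages hM hP hD (mem_filter.1 hi).2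
  refine ⟨StageParams.exists_isTwoStage (fun i hi => (ht i hi).one_le_d)
    (fun i hi => (ht i hi).one_le_e) ?_, fun π hπ => ?_⟩
  · refine le_of_eq_of_le (congrArg card ?_) hs₀
    ext i
    simp [stageParams]
  -- Arms outside `S` have `h = 0`, so discarding them preserves the balance.
  · have hbal : M * D.lam = ∑ i ∈ (stageParams T P D).S, D.h i := by
      rw [hD.1.balance]
      exact (sum_filter_of_ne fun i _ hne => lt_of_le_of_ne (hD.1.h_nonneg i) hne.symm).symm
    obtain ⟨C, hC⟩ := ProbeBandit.le_expValue_of_isTwoStage hD.1.lam_nonneg hbal ht hπ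
    exact (hopt T hT D hD.1).trans (ProbeBandit.le_guaranteedValue hD.1 hT1 hC)
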